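/- Let $M$ be a Riemann surface and $n\ge 0$. An *extended solution* is a smooth map $\Phi:S^1\times M\to \mathrm U(n)$ with $\Phi(1,\cdot)=I$ such that, for every local complex coordinate $z$ on $M$, there are $\mathfrak{gl}(n,\mathbb C)$-valued maps $A_z,A_{\bar z}$, independent of $\lambda\in S^1$, with $$\Phi(\lambda,\cdot)^{-1}d\Phi(\lambda,\cdot)=(1-\lambda^{-1})A_z\,dz+(1-\lambda)A_{\bar z}\,d\bar z\qquad(\lambda\in S^1).$$ It is *associated* to a smooth map $\varphi:M\to \mathrm U(n)$ if this holds with $A_z\,dz+A_{\bar z}\,d\bar z=\tfrac12\varphi^{-1}d\varphi$ (such a $\varphi$ is then harmonic). A harmonic map $\varphi:M\to\mathrm U(n)$ has *finite uniton number* if there is an extended solution associated to $\varphi$, defined on the whole of $M$, which is a trigonometric polynomial in $\lambda$, that is, of the form $\sum_{m=-N}^{N}\lambda^mT_m(z)$ with $N$ independent of $z\in M$. Let $k\ge 2$ and $\omega=e^{2\pi i/k}$. Let $\mathcal H_+\subset L^2(S^1,\mathbb C^n)$ be the Hardy space of functions whose negative Fourier coefficients vanish. An extended solution $\Phi$ is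 *$k$-symmetric* if for every $z\in M$ the subspace $W(z)=\Phi(\cdot,z)\mathcal H_+$ is invariant under $f\mapsto f_\omega$, $f_\omega(\lambda)=f(\omega\lambda)$. **Proposition.** Let $\Phi$ be a $k$-symmetric extended solution. Put $\varphi_k=\Phi(\omega,\cdot)$, and for $0\le j\le k-1$ let $\pi_j(z)$ be the orthogonal projection of $\mathbb C^n$ onto $\ker(\varphi_k(z)-\omega^jI)$. Then $$\Phi_k(\lambda,z)=\Phi(\lambda,z)\sum_{j=0}^{k-1}\lambda^{-j}\pi_j(z)$$ is a function of $\lambda^k$ (and $z$), so that $\Psi(\lambda^k,z)=\Phi_k(\lambda,z)$ defines a map $\Psi$ on $S^1\times M$; this $\Psi$ is an extended solution; and $\varphi=\Phi(-1,\cdot)$ has finite uniton number if and only if $\psi=\Psi(-1,\cdot)$ has finite uniton number. -/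

import Mathlib

open scoped Manifold ContDiff

noncomputable section

namespace HarmonicLoops

/-! Throughout, a Riemann surface `M` is a topological space with an atlas of complex charts
(`ChartedSpace ℂ M`, `IsManifold 𝓘(ℂ) ω M`), `Circle` is the unit circle `S¹` in `ℂ`, and a map
into `U(n)` is a map into `n × n` complex matrices with values in `Matrix.unitaryGroup`. -/

/-- Square complex matrices of order `n`. -/
abbrev Mat (n : ℕ) : Type := Matrix (Fin n) (Fin n) ℂ

/-! ### Wirtinger derivatives -/

/-- `∂F/∂z = (∂F/∂x - i ∂F/∂y) / 2`, entry by entry, for a matrix-valued function of `z = x + iy`. -/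
def dz {n : ℕ} (F : ℂ → Mat n) (w : ℂ) : Mat n :=
  Matrix.of fun i j =>
    (fderiv ℝ (fun v => F v i j) w 1 - Complex.I * fderiv ℝ (fun v => F v i j) w Complex.I) / 2

/-- `∂F/∂z̄ = (∂F/∂x + i ∂F/∂y) / 2`, entry by entry, for a matrix-valued function of `z = x + iy`. -/
def dzbar {n : ℕ} (F : ℂ → Mat n) (w : ℂ) : Mat n :=
  Matrix.of fun i j =>
    (fderiv ℝ (fun v => F v i j) w 1 + Complex.I * fderiv ℝ (fun v => F v i j) w Complex.I) / 2

/-! ### Extended solutions and the uniton number -/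

section Extended

variable {M : Type*} [TopologicalSpace M] [ChartedSpace ℂ M]

/-- The map `Φ : S¹ × M → U(n)` is an extended solution: it is smooth, `Φ(1, ·) = I`, and in every
local complex coordinate `e` there are matrix-valued `A_z`, `A_z̄`, not depending on `ζ ∈ S¹`, with
`Φ(ζ, ·)⁻¹ dΦ(ζ, ·) = (1 - ζ⁻¹) A_z dz + (1 - ζ) A_z̄ dz̄`. -/
structure IsExtendedSolution {n : ℕ} (Φ : Circle → M → Mat n) : Prop where
  unitary : ∀ ζ p, Φ ζ p ∈ Matrix.unitaryGroup (Fin n) ℂ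
  smooth : ∀ i j, ContMDiff ((𝓡 1).prod 𝓘(ℝ, ℂ)) 𝓘(ℝ, ℂ) ∞ fun q : Circle × M => Φ q.1 q.2 i j
  based : ∀ p, Φ 1 p = 1
  form : ∀ e ∈ IsManifold.maximalAtlas 𝓘(ℂ) ω M, ∃ A B : ℂ → Mat n,
    ∀ ζ : Circle, ∀ w ∈ e.target,
      (Φ ζ (e.symm w))⁻¹ * dz (fun v => Φ ζ (e.symm v)) w = (1 - (ζ : ℂ)⁻¹) • A w ∧
      (Φ ζ (e.symm w))⁻¹ * dzbar (fun v => Φ ζ (e.symm v)) w = (1 - (ζ : ℂ)) • B w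

/-- The map `φ : M → U(n)` is smooth. -/
structure IsSmoothUnitary {n : ℕ} (φ : M → Mat n) : Prop where
  unitary : ∀ p, φ p ∈ Matrix.unitaryGroup (Fin n) ℂ
  smooth : ∀ i j, ContMDiff 𝓘(ℝ, ℂ) 𝓘(ℝ, ℂ) ∞ fun p => φ p i j

/-- The extended solution `Φ` is associated to `φ : M → U(n)`: with
`½ φ⁻¹ dφ = A_z dz + A_z̄ dz̄` one has
`Φ(ζ, ·)⁻¹ dΦ(ζ, ·) = (1 - ζ⁻¹) A_z dz + (1 - ζ) A_z̄ dz̄` in every local complex coordinate. -/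
def IsAssociated {n : ℕ} (Φ : Circle → M → Mat n) (φ : M → Mat n) : Prop :=
  ∀ e ∈ IsManifold.maximalAtlas 𝓘(ℂ) ω M, ∀ ζ : Circle, ∀ w ∈ e.target,
    (Φ ζ (e.symm w))⁻¹ * dz (fun v => Φ ζ (e.symm v)) w =
      (1 - (ζ : ℂ)⁻¹) • ((1 / 2 : ℂ) • ((φ (e.symm w))⁻¹ * dz (fun v => φ (e.symm v)) w)) ∧
    (Φ ζ (e.symm w))⁻¹ * dzbar (fun v => Φ ζ (e.symm v)) w =
      (1 - (ζ : ℂ)) • ((1 / 2 : ℂ) • ((φ (e.symm w))⁻¹ * dzbar (fun v => φ (e.symm v)) w))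

end Extended

/-- `Φ(ζ, p)` is a trigonometric polynomial in `ζ ∈ S¹`: `Φ(ζ, p) = ∑_{|m| ≤ N} ζ ^ m T_m(p)`. -/
def IsTrigPolynomial {M : Type*} {n : ℕ} (Φ : Circle → M → Mat n) : Prop :=
  ∃ (N : ℕ) (T : ℤ → M → Mat n), ∀ (ζ : Circle) (p : M),
    Φ ζ p = ∑ m ∈ Finset.Icc (-(N : ℤ)) N, (ζ : ℂ) ^ m • T m p

/-- The map `φ : M → U(n)` has finite uniton number: there is an extended solution, defined on the
whole of `M`, associated to `φ`, that is a trigonometric polynomial in `ζ ∈ S¹`. (A smooth map with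
an associated extended solution is harmonic, so this is a notion for harmonic maps.) -/
def HasFiniteUnitonNumber {M : Type*} [TopologicalSpace M] [ChartedSpace ℂ M] {n : ℕ}
    (φ : M → Mat n) : Prop :=
  IsSmoothUnitary φ ∧
    ∃ Φ : Circle → M → Mat n, IsExtendedSolution Φ ∧ IsAssociated Φ φ ∧ IsTrigPolynomial Φ

/-! ### The Hilbert space `L²(S¹, ℂⁿ)` and `k`-symmetry

Functions on `S¹` are written in the variable `t ∈ ℝ/ℤ`, where `ζ = exp (2πit) = t.toCircle`, and
`S¹` carries its rotation-invariant probability measure. -/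

/-- `L²(S¹, ℂⁿ)`. -/
abbrev L2 (n : ℕ) : Type :=
  MeasureTheory.Lp (EuclideanSpace ℂ (Fin n)) 2
    (AddCircle.haarAddCircle : MeasureTheory.Measure UnitAddCircle)

/-- The Hardy space `H₊`: all negative Fourier coefficients vanish. -/
def hardySpace (n : ℕ) : Set (L2 n) :=
  {f | ∀ m : ℤ, m < 0 → fourierCoeff (f : UnitAddCircle → EuclideanSpace ℂ (Fin n)) m = 0}

/-- The subspace `γ H₊` of `L²(S¹, ℂⁿ)`, for a loop `γ` of matrices. -/
def loopSpace {n : ℕ} (γ : Circle → Mat n) : Set (L2 n) :=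
  {f | ∃ h ∈ hardySpace n, ∀ᵐ t ∂(AddCircle.haarAddCircle : MeasureTheory.Measure UnitAddCircle),
    f t = Matrix.toEuclideanLin (γ t.toCircle) (h t)}

/-- The rotation `f ↦ f_ω`, `f_ω(ζ) = f(ωζ)` with `ω = exp (2πi/k)`, that is, `t ↦ t + 1/k`. -/
def rotate {n : ℕ} (k : ℕ) (f : L2 n) : L2 n :=
  MeasureTheory.Lp.compMeasurePreserving (fun t : UnitAddCircle => t + ((1 / k : ℝ) : UnitAddCircle))
    (MeasureTheory.measurePreserving_add_right AddCircle.haarAddCircle _) f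

/-- The subspaces `W(p) = Φ(·, p) H₊` are `k`-symmetric: `f ∈ W(p)` implies `f_ω ∈ W(p)`. -/
def IsKSymmetric {M : Type*} {n : ℕ} (k : ℕ) (Φ : Circle → M → Mat n) : Prop :=
  ∀ p : M, ∀ f ∈ loopSpace (fun ζ => Φ ζ p), rotate k f ∈ loopSpace (fun ζ => Φ ζ p)

/-! ### The loop `Ψ` obtained from `Φ` -/

/-- The primitive root of unity `ω = exp (2πi/k)`. -/
def rootOfUnity (k : ℕ) : Circle := Circle.exp (2 * Real.pi / k)

/-- The matrix of the orthogonal projection of `ℂⁿ` onto a subspace. -/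
def projMatrix {n : ℕ} (K : Submodule ℂ (EuclideanSpace ℂ (Fin n))) : Mat n :=
  Matrix.toEuclideanLin.symm (K.starProjection : EuclideanSpace ℂ (Fin n) →ₗ[ℂ] _)

/-- `π_j(p)`: the orthogonal projection onto `β_j(p) = ker (φ_k(p) - ω ^ j I)`, where
`φ_k = Φ(ω, ·)` is the matrix with `Φ(ωζ, p) = Φ(ζ, p) φ_k(p)` (recall `Φ(1, ·) = I`). -/
def eigenProj {M : Type*} {n : ℕ} (k : ℕ) (Φ : Circle → M → Mat n) (j : ℕ) (p : M) : Mat n :=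
  projMatrix (LinearMap.ker
    (Matrix.toEuclideanLin (Φ (rootOfUnity k) p - (rootOfUnity k : ℂ) ^ j • (1 : Mat n))))

/-- `Φ_k(ζ, p) = Φ(ζ, p) ∑_{j < k} ζ ^ (-j) π_j(p)`. -/
def twistedLoop {M : Type*} {n : ℕ} (k : ℕ) (Φ : Circle → M → Mat n) : Circle → M → Mat n :=
  fun ζ p => Φ ζ p * ∑ j ∈ Finset.range k, (ζ : ℂ) ^ (-(j : ℤ)) • eigenProj k Φ j p

/-- `Ψ(ζ, p) = Φ_k(ζ ^ (1/k), p)`, with the principal `k`-th root. -/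
def reducedLoop {M : Type*} {n : ℕ} (k : ℕ) (Φ : Circle → M → Mat n) : Circle → M → Mat n :=
  fun ζ p => twistedLoop k Φ (Circle.exp (Complex.arg ζ / k)) p

end HarmonicLoops

end

open HarmonicLoops

namespace HarmonicLoops

/-! ### Roots of unity and spectral projections -/

/-! Symmetry of `W(z)` gives the cocycle identity `Φ(ωζ) = Φ(ζ) φ_k` (`apply_rootOfUnity_mul`).
Indeed `Φ(ζ)⁻¹ Φ(ωζ)` has no negative Fourier coefficients because rotation preserves `W`; the
inverse rotation is a power of the rotation, so the adjoint has none either, and the loop is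
constant. Hence `φ_k ^ k = 1`, and the eigenprojections `π_j` are polynomials in `φ_k`, so they are
smooth and sum to `I`.

Write `γ(ζ) = ∑ ζ^(-j) π_j`. Under `ζ ↦ ωζ` the factor `φ_k` gained by `Φ` cancels the factors
`ω^(-j)` gained by `γ`, so `Φ_k = Φγ` depends on `ζ^k` only.

That `Ψ` is an extended solution is a degree count. The form `Φ_k⁻¹ dΦ_k = γ⁻¹ (Φ⁻¹ dΦ) γ + γ⁻¹ dγ`
has exponents in `[-k, k-1]` in its `dz` part and in `[1-k, k]` in its `dz̄` part. Rotation
invariance leaves only multiples of `k`, that is `-k, 0` and `0, k`, and vanishing at `ζ = 1` forces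
the factors `1 - ζ^(-k)` and `1 - ζ^k`.

For the uniton number, extended solutions associated to the same map differ by a locally constant
left factor. So finiteness is a property of `Φ(ζ, p₀)⁻¹ Φ(ζ, p)`, with `p₀` a base point in the
component of `p` (`hasFiniteUnitonNumber_iff`). For `Φ` and `Ψ` these normalized loops differ by
factors `γ` and `γ⁻¹`, whose degrees are less than `k` at every point. -/

theorem sum_zpow_pow_root {k : ℕ} {w : ℂ} (hw : IsPrimitiveRoot w k) (m : ℤ) :
    ∑ j ∈ Finset.range k, (w ^ m) ^ j = if (k : ℤ) ∣ m then (k : ℂ) else 0 := by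
  split_ifs with h
  · rw [(hw.zpow_eq_one_iff_dvd m).2 h]
    simp
  · have h1 : w ^ m ≠ 1 := fun h1 => h ((hw.zpow_eq_one_iff_dvd m).1 h1)
    rw [geom_sum_eq h1, ← zpow_natCast, ← zpow_mul, mul_comm, zpow_mul, zpow_natCast, hw.pow_eq_one]
    simp

theorem isPrimitiveRoot_rootOfUnity {k : ℕ} (hk : k ≠ 0) :
    IsPrimitiveRoot ((rootOfUnity k : Circle) : ℂ) k := by
  have h := Complex.isPrimitiveRoot_exp k hk
  convert h using 1
  rw [rootOfUnity, Circle.coe_exp]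
  congr 1
  push_cast
  ring

theorem rootOfUnity_pow {k : ℕ} (hk : k ≠ 0) : rootOfUnity k ^ k = 1 := by
  apply Circle.ext
  rw [Circle.coe_pow, (isPrimitiveRoot_rootOfUnity hk).pow_eq_one, Circle.coe_one]

variable {n : ℕ}

/-- The spectral projection onto the `w ^ j`-eigenspace of a matrix `φ` with `φ ^ k = 1`. -/
noncomputable def spectralProj (k : ℕ) (w : ℂ) (φ : Mat n) (j : ℕ) : Mat n :=
  (k : ℂ)⁻¹ • ∑ r ∈ Finset.range k, (w ^ (-(j : ℤ))) ^ r • φ ^ r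

section Spectral

variable {k : ℕ} {w : ℂ} {φ : Mat n}

theorem mul_spectralProj (hw : IsPrimitiveRoot w k) (hw0 : w ≠ 0) (hφ : φ ^ k = 1) (j : ℕ) :
    φ * spectralProj k w φ j = w ^ j • spectralProj k w φ j := by
  have hv : (w ^ (-(j : ℤ))) ^ k = 1 := by
    rw [← zpow_natCast, ← zpow_mul, mul_comm, zpow_mul, zpow_natCast, hw.pow_eq_one, one_zpow]
  have hwv : w ^ j * w ^ (-(j : ℤ)) = 1 := by
    rw [zpow_neg, zpow_natCast]
    exact mul_inv_cancel₀ (pow_ne_zero _ hw0)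
  generalize w ^ (-(j : ℤ)) = v at hv hwv
  -- The sum is cyclic: the term `r = k` equals the term `r = 0`, since `v ^ k = 1` and `φ ^ k = 1`.
  have key : ∑ r ∈ Finset.range k, v ^ (r + 1) • φ ^ (r + 1)
      = ∑ r ∈ Finset.range k, v ^ r • φ ^ r := by
    have h1 := Finset.sum_range_succ (fun r => v ^ r • φ ^ r) k
    have h2 := Finset.sum_range_succ' (fun r => v ^ r • φ ^ r) k
    rw [h1] at h2
    simpa [hv, hφ] using h2.symm
  rw [spectralProj, Matrix.mul_smul, smul_comm (w ^ j)]
  have hv' : w ^ (-(j : ℤ)) = v := by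
    rw [zpow_neg, zpow_natCast]
    exact (eq_inv_of_mul_eq_one_right hwv).symm
  rw [hv']
  congr 1
  conv_rhs => rw [← key, Finset.smul_sum]
  rw [Finset.mul_sum]
  refine Finset.sum_congr rfl fun r _ => ?_
  rw [Matrix.mul_smul, ← pow_succ', smul_smul, pow_succ v, mul_left_comm, hwv, mul_one]

theorem pow_mul_spectralProj (hw : IsPrimitiveRoot w k) (hw0 : w ≠ 0) (hφ : φ ^ k = 1) (j r : ℕ) :
    φ ^ r * spectralProj k w φ j = (w ^ j) ^ r • spectralProj k w φ j := by
  induction r with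
  | zero => simp
  | succ r ih =>
    rw [pow_succ, mul_assoc, mul_spectralProj hw hw0 hφ, Matrix.mul_smul, ih, smul_smul, pow_succ,
      mul_comm]

theorem sum_spectralProj (hw : IsPrimitiveRoot w k) (hk : k ≠ 0) :
    ∑ j ∈ Finset.range k, spectralProj k w φ j = 1 := by
  have hk' : (k : ℂ) ≠ 0 := Nat.cast_ne_zero.2 hk
  simp only [spectralProj]
  rw [← Finset.smul_sum, Finset.sum_comm]
  -- Orthogonality of characters: after exchanging the sums only `r = 0` survives.
  have h : ∀ r ∈ Finset.range k, ∑ j ∈ Finset.range k, (w ^ (-(j : ℤ))) ^ r • φ ^ r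
      = if r = 0 then (k : ℂ) • (1 : Mat n) else 0 := by
    intro r hr
    rw [← Finset.sum_smul]
    have h1 : ∀ j ∈ Finset.range k, (w ^ (-(j : ℤ))) ^ r = (w ^ (-(r : ℤ))) ^ j := by
      intro j _
      rw [← zpow_natCast, ← zpow_natCast, ← zpow_mul, ← zpow_mul]
      congr 1
      ring
    rw [Finset.sum_congr rfl h1, sum_zpow_pow_root hw]
    rcases Nat.eq_zero_or_pos r with h0 | h0
    · simp [h0]
    · rw [if_neg h0.ne', if_neg, zero_smul]
      rw [dvd_neg, Int.natCast_dvd_natCast]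
      exact fun hd => absurd (Nat.le_of_dvd h0 hd) (not_le.2 (Finset.mem_range.1 hr))
  rw [Finset.sum_congr rfl h, Finset.sum_ite_eq' (Finset.range k) 0,
    if_pos (Finset.mem_range.2 (Nat.pos_of_ne_zero hk)), smul_smul, inv_mul_cancel₀ hk', one_smul]

theorem spectralProj_mul (hw : IsPrimitiveRoot w k) (hw0 : w ≠ 0) (hk : k ≠ 0) (hφ : φ ^ k = 1)
    {i j : ℕ} (hi : i < k) (hj : j < k) :
    spectralProj k w φ i * spectralProj k w φ j = if i = j then spectralProj k w φ j else 0 := by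
  have hk' : (k : ℂ) ≠ 0 := Nat.cast_ne_zero.2 hk
  nth_rewrite 1 [spectralProj]
  rw [Matrix.smul_mul, Finset.sum_mul]
  have h : ∀ r ∈ Finset.range k, (w ^ (-(i : ℤ))) ^ r • φ ^ r * spectralProj k w φ j
      = (w ^ ((j : ℤ) - i)) ^ r • spectralProj k w φ j := by
    intro r _
    rw [Matrix.smul_mul, pow_mul_spectralProj hw hw0 hφ, smul_smul, ← mul_pow, ← zpow_natCast w j,
      ← zpow_add₀ hw0, neg_add_eq_sub]
  rw [Finset.sum_congr rfl h, ← Finset.sum_smul, sum_zpow_pow_root hw]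
  by_cases hij : i = j
  · subst hij
    simp [smul_smul, hk']
  · rw [if_neg hij, if_neg, zero_smul, smul_zero]
    intro hd
    obtain ⟨c, hc⟩ := hd
    -- Since `|j - i| < k`, the only possible multiple of `k` is `0`.
    have h1 : c = 0 := by
      by_contra hc0
      rcases lt_or_gt_of_ne hc0 with h | h
      · nlinarith
      · nlinarith
    rw [h1, mul_zero] at hc
    omega

end Spectral

theorem toEuclideanLin_mul_apply (A B : Mat n) (v : EuclideanSpace ℂ (Fin n)) :
    Matrix.toEuclideanLin (A * B) v = Matrix.toEuclideanLin A (Matrix.toEuclideanLin B v) := by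
  simp [Matrix.toEuclideanLin]

theorem toEuclideanLin_one_apply (v : EuclideanSpace ℂ (Fin n)) :
    Matrix.toEuclideanLin (1 : Mat n) v = v := by
  simp [Matrix.toEuclideanLin]

/-- The averaged polynomial maps into the eigenspace, and `v` minus its image is orthogonal to each
eigenvector `u`, because every term of the average has the same inner product with `u` as `v` has.
The polynomial form makes smooth dependence on `φ` visible, which the kernel does not. -/
theorem projMatrix_ker_eq_spectralProj {k : ℕ} {w : ℂ} (hw : IsPrimitiveRoot w k)
    (hk : k ≠ 0) {φ : Mat n} (hφu : φ ∈ Matrix.unitaryGroup (Fin n) ℂ)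
    (hφ : φ ^ k = 1) (j : ℕ) :
    projMatrix (LinearMap.ker (Matrix.toEuclideanLin (φ - w ^ j • (1 : Mat n))))
      = spectralProj k w φ j := by
  have hw0 : w ≠ 0 := hw.ne_zero hk
  have hwn : ‖w‖ = 1 := hw.norm'_eq_one hk
  have hk' : (k : ℂ) ≠ 0 := Nat.cast_ne_zero.2 hk
  have hker : ∀ v, v ∈ LinearMap.ker (Matrix.toEuclideanLin (φ - w ^ j • (1 : Mat n))) ↔
      Matrix.toEuclideanLin φ v = w ^ j • v := by
    intro v
    rw [LinearMap.mem_ker, map_sub, map_smul, LinearMap.sub_apply, LinearMap.smul_apply,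
      toEuclideanLin_one_apply, sub_eq_zero]
  rw [projMatrix, LinearEquiv.symm_apply_eq]
  ext1 v
  refine Submodule.eq_starProjection_of_mem_of_inner_eq_zero ?_ ?_
  · rw [hker, ← toEuclideanLin_mul_apply, mul_spectralProj hw hw0 hφ, map_smul,
      LinearMap.smul_apply]
  · intro u hu
    rw [hker] at hu
    have hpow : ∀ r : ℕ, inner ℂ (Matrix.toEuclideanLin (φ ^ r) v) u
        = (w ^ (-(j : ℤ))) ^ r * inner ℂ v u := by
      -- For unitary `φ` the adjoint is the inverse, so `u` is an eigenvector of it with the inverse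
      -- eigenvalue.
      have hstar : Matrix.toEuclideanLin φ.conjTranspose u = w ^ (-(j : ℤ)) • u := by
        have h1 : Matrix.toEuclideanLin φ.conjTranspose (Matrix.toEuclideanLin φ u) = u := by
          rw [← toEuclideanLin_mul_apply]
          rw [← Matrix.star_eq_conjTranspose, (Matrix.mem_unitaryGroup_iff').1 hφu,
            toEuclideanLin_one_apply]
        rw [hu, map_smul] at h1
        rw [zpow_neg, zpow_natCast, eq_inv_smul_iff₀ (pow_ne_zero _ hw0)]
        exact h1
      intro r
      induction r with
      | zero => rw [pow_zero, pow_zero, toEuclideanLin_one_apply, one_mul]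
      | succ r ih =>
        rw [pow_succ', toEuclideanLin_mul_apply, ← LinearMap.adjoint_inner_right,
          ← Matrix.toEuclideanLin_conjTranspose_eq_adjoint, hstar, inner_smul_right, ih, pow_succ']
        ring
    have hconj : ∀ r : ℕ, (starRingEnd ℂ) ((w ^ (-(j : ℤ))) ^ r) * (w ^ (-(j : ℤ))) ^ r = 1 := by
      intro r
      rw [mul_comm, Complex.mul_conj, Complex.normSq_eq_norm_sq]
      simp [hwn]
    rw [inner_sub_left, sub_eq_zero, spectralProj, map_smul, LinearMap.smul_apply, map_sum,
      LinearMap.sum_apply, inner_smul_left, sum_inner]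
    have h2 : ∀ r ∈ Finset.range k,
        inner ℂ (Matrix.toEuclideanLin ((w ^ (-(j : ℤ))) ^ r • φ ^ r) v) u = inner ℂ v u := by
      intro r _
      rw [map_smul, LinearMap.smul_apply, inner_smul_left, hpow, ← mul_assoc, hconj, one_mul]
    rw [Finset.sum_congr rfl h2]
    simp [hk']

theorem conjTranspose_projMatrix (K : Submodule ℂ (EuclideanSpace ℂ (Fin n))) :
    (projMatrix K).conjTranspose = projMatrix K := by
  apply Matrix.toEuclideanLin.injective
  rw [Matrix.toEuclideanLin_conjTranspose_eq_adjoint, projMatrix, LinearEquiv.apply_symm_apply]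
  symm
  rw [LinearMap.eq_adjoint_iff]
  intro x y
  exact Submodule.inner_starProjection_left_eq_right K x y

/-! ### The factor `∑ ζ ^ (-j) π_j` -/

/-- `∑_{j < k} ζ ^ (-j) P_j`. -/
noncomputable def gradingLoop (k : ℕ) (P : ℕ → Mat n) (ζ : Circle) : Mat n :=
  ∑ j ∈ Finset.range k, (ζ : ℂ) ^ (-(j : ℤ)) • P j

/-- `P_0, …, P_{k-1}` is a complete system of pairwise orthogonal projections. -/
structure IsProjSystem (k : ℕ) (P : ℕ → Mat n) : Prop where
  sum_eq : ∑ j ∈ Finset.range k, P j = 1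
  mul_eq : ∀ i < k, ∀ j < k, P i * P j = if i = j then P j else 0
  herm : ∀ j, (P j).conjTranspose = P j

namespace IsProjSystem

variable {k : ℕ} {P : ℕ → Mat n}

theorem conjTranspose_gradingLoop (h : IsProjSystem k P) (ζ : Circle) :
    (gradingLoop k P ζ).conjTranspose = ∑ j ∈ Finset.range k, (ζ : ℂ) ^ (j : ℤ) • P j := by
  rw [gradingLoop, Matrix.conjTranspose_sum]
  refine Finset.sum_congr rfl fun j _ => ?_
  rw [Matrix.conjTranspose_smul, h.herm]
  congr 1
  simp [← Circle.coe_inv_eq_conj]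

theorem conjTranspose_mul_gradingLoop (h : IsProjSystem k P) (ζ : Circle) :
    (gradingLoop k P ζ).conjTranspose * gradingLoop k P ζ = 1 := by
  rw [h.conjTranspose_gradingLoop, gradingLoop, Finset.sum_mul_sum, ← h.sum_eq]
  refine Finset.sum_congr rfl fun i hi => ?_
  rw [Finset.sum_eq_single_of_mem i hi]
  · rw [Matrix.smul_mul, Matrix.mul_smul, smul_smul, ← zpow_add₀ ζ.coe_ne_zero, add_neg_cancel,
      zpow_zero, one_smul, h.mul_eq i (Finset.mem_range.1 hi) i (Finset.mem_range.1 hi), if_pos rfl]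
  · intro j hj hij
    rw [Matrix.smul_mul, Matrix.mul_smul, h.mul_eq i (Finset.mem_range.1 hi) j
      (Finset.mem_range.1 hj), if_neg hij.symm, smul_zero, smul_zero]

theorem gradingLoop_mem_unitaryGroup (h : IsProjSystem k P) (ζ : Circle) :
    gradingLoop k P ζ ∈ Matrix.unitaryGroup (Fin n) ℂ :=
  Matrix.mem_unitaryGroup_iff'.2 (h.conjTranspose_mul_gradingLoop ζ)

theorem gradingLoop_one (h : IsProjSystem k P) : gradingLoop k P 1 = 1 := by
  simp [gradingLoop, h.sum_eq]

end IsProjSystem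

/-! ### Laurent polynomials in `ζ` -/

/-- Matrix-valued Laurent polynomials with exponents between `a` and `b`, as functions on the
circle. -/
def laurent (n : ℕ) (a b : ℤ) : Submodule ℂ (Circle → Mat n) :=
  Submodule.span ℂ
    {F | ∃ (m : ℤ) (X : Mat n), a ≤ m ∧ m ≤ b ∧ F = fun ζ : Circle => (ζ : ℂ) ^ m • X}

section Laurent

variable {a b c d : ℤ} {F G : Circle → Mat n}

theorem monomial_mem_laurent {m : ℤ} (ha : a ≤ m) (hb : m ≤ b) (X : Mat n) :
    (fun ζ : Circle => (ζ : ℂ) ^ m • X) ∈ laurent n a b :=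
  Submodule.subset_span ⟨m, X, ha, hb, rfl⟩

theorem mem_laurent_iff : F ∈ laurent n a b ↔
    ∃ X : ℤ → Mat n, ∀ ζ : Circle, F ζ = ∑ m ∈ Finset.Icc a b, (ζ : ℂ) ^ m • X m := by
  constructor
  · intro h
    induction h using Submodule.span_induction with
    | mem F hF =>
      obtain ⟨m, X, ha, hb, rfl⟩ := hF
      refine ⟨fun l => if l = m then X else 0, fun ζ => ?_⟩
      rw [Finset.sum_eq_single_of_mem m (Finset.mem_Icc.2 ⟨ha, hb⟩)]
      · simp
      · intro l _ hl
        simp [hl]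
    | zero => exact ⟨0, fun ζ => by simp⟩
    | add F G _ _ hF hG =>
      obtain ⟨X, hX⟩ := hF
      obtain ⟨Y, hY⟩ := hG
      exact ⟨X + Y, fun ζ => by simp [hX, hY, Finset.sum_add_distrib]⟩
    | smul t F _ hF =>
      obtain ⟨X, hX⟩ := hF
      refine ⟨t • X, fun ζ => ?_⟩
      rw [Pi.smul_apply, hX, Finset.smul_sum]
      exact Finset.sum_congr rfl fun m _ => smul_comm _ _ _
  · rintro ⟨X, hX⟩
    have : F = ∑ m ∈ Finset.Icc a b, fun ζ : Circle => (ζ : ℂ) ^ m • X m := by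
      funext ζ
      rw [hX, Finset.sum_apply]
    rw [this]
    exact Submodule.sum_mem _ fun m hm =>
      monomial_mem_laurent (Finset.mem_Icc.1 hm).1 (Finset.mem_Icc.1 hm).2 _

theorem laurent_mono (hc : c ≤ a) (hd : b ≤ d) : laurent n a b ≤ laurent n c d :=
  Submodule.span_mono fun _ ⟨m, X, ha, hb, h⟩ => ⟨m, X, hc.trans ha, hb.trans hd, h⟩

theorem mul_mem_laurent (hF : F ∈ laurent n a b) (hG : G ∈ laurent n c d) :
    F * G ∈ laurent n (a + c) (b + d) := by
  have h := Submodule.mul_mem_mul hF hG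
  rw [laurent, laurent, Submodule.span_mul_span] at h
  refine Submodule.span_mono ?_ h
  rintro _ ⟨_, ⟨m, X, ha, hb, rfl⟩, _, ⟨l, Y, hc, hd, rfl⟩, rfl⟩
  refine ⟨m + l, X * Y, add_le_add ha hc, add_le_add hb hd, ?_⟩
  funext ζ
  simp only [Pi.mul_apply, Matrix.smul_mul, Matrix.mul_smul, smul_smul]
  rw [zpow_add₀ ζ.coe_ne_zero, mul_comm]

theorem conjTranspose_mem_laurent (hF : F ∈ laurent n a b) :
    (fun ζ => (F ζ).conjTranspose) ∈ laurent n (-b) (-a) := by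
  obtain ⟨X, hX⟩ := mem_laurent_iff.1 hF
  have : (fun ζ => (F ζ).conjTranspose)
      = ∑ m ∈ Finset.Icc a b, fun ζ : Circle => (ζ : ℂ) ^ (-m) • (X m).conjTranspose := by
    funext ζ
    rw [hX, Finset.sum_apply, Matrix.conjTranspose_sum]
    refine Finset.sum_congr rfl fun m _ => ?_
    rw [Matrix.conjTranspose_smul]
    congr 1
    simp [← Circle.coe_inv_eq_conj]
  rw [this]
  exact Submodule.sum_mem _ fun m hm =>
    monomial_mem_laurent (neg_le_neg (Finset.mem_Icc.1 hm).2) (neg_le_neg (Finset.mem_Icc.1 hm).1) _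

theorem gradingLoop_mem_laurent (k : ℕ) (P : ℕ → Mat n) :
    gradingLoop k P ∈ laurent n (1 - k) 0 := by
  have : gradingLoop k P
      = ∑ j ∈ Finset.range k, fun ζ : Circle => (ζ : ℂ) ^ (-(j : ℤ)) • P j := by
    funext ζ
    rw [gradingLoop, Finset.sum_apply]
  rw [this]
  refine Submodule.sum_mem _ fun j hj => ?_
  have := Finset.mem_range.1 hj
  exact monomial_mem_laurent (by omega) (by omega) _

/-- A Laurent polynomial that is invariant under a rotation of order `k` only has exponents
divisible by `k`. -/
theorem exists_eq_sum_dvd_of_invariant {k : ℕ} (hk : k ≠ 0) {w : Circle}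
    (hw : IsPrimitiveRoot (w : ℂ) k) (hF : F ∈ laurent n a b) (hinv : ∀ ζ, F (w * ζ) = F ζ) :
    ∃ X : ℤ → Mat n, ∀ ζ : Circle,
      F ζ = ∑ m ∈ Finset.Icc a b with (k : ℤ) ∣ m, (ζ : ℂ) ^ m • X m := by
  have hk' : (k : ℂ) ≠ 0 := Nat.cast_ne_zero.2 hk
  obtain ⟨X, hX⟩ := mem_laurent_iff.1 hF
  refine ⟨X, fun ζ => ?_⟩
  have hpow : ∀ r : ℕ, F (w ^ r * ζ) = F ζ := by
    intro r
    induction r with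
    | zero => simp
    | succ r ih => rw [pow_succ', mul_assoc, hinv, ih]
  -- Averaging over the `k` rotations kills the exponents not divisible by `k`.
  have h1 : (k : ℂ) • F ζ = ∑ r ∈ Finset.range k, F (w ^ r * ζ) := by
    simp [hpow, Nat.cast_smul_eq_nsmul]
  have h2 : (k : ℂ) • F ζ
      = (k : ℂ) • ∑ m ∈ Finset.Icc a b with (k : ℤ) ∣ m, (ζ : ℂ) ^ m • X m := by
    rw [h1]
    simp only [hX]
    rw [Finset.sum_comm, Finset.sum_filter, Finset.smul_sum]
    refine Finset.sum_congr rfl fun m _ => ?_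
    have h3 : ∀ r ∈ Finset.range k, ((w ^ r * ζ : Circle) : ℂ) ^ m • X m
        = ((w : ℂ) ^ m) ^ r • ((ζ : ℂ) ^ m • X m) := by
      intro r _
      rw [smul_smul, Circle.coe_mul, Circle.coe_pow, mul_zpow]
      congr 2
      rw [← zpow_natCast, ← zpow_natCast, ← zpow_mul, ← zpow_mul, mul_comm]
    rw [Finset.sum_congr rfl h3, ← Finset.sum_smul, sum_zpow_pow_root hw]
    split_ifs <;> simp
  exact smul_right_injective _ hk' h2

end Laurent

end HarmonicLoops

namespace HarmonicLoops

open MeasureTheory AddCircle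

/-! ### Rotation-invariant loop spaces -/

variable {n : ℕ}

/-- With a single possibly nonzero coefficient the Fourier series is summable, so it converges
pointwise to the continuous function `f`. -/
theorem eq_apply_zero_of_fourierCoeff_eq_zero {f : UnitAddCircle → ℂ} (hf : Continuous f)
    (h : ∀ m : ℤ, m ≠ 0 → fourierCoeff f m = 0) (t : UnitAddCircle) : f t = f 0 := by
  have hs : HasSum (fourierCoeff f) (fourierCoeff f 0) := hasSum_single 0 h
  have hc : ∀ s, f s = fourierCoeff f 0 := by
    intro s
    have h1 := has_pointwise_sum_fourier_series_of_summable (f := ⟨f, hf⟩) hs.summable s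
    have h2 : HasSum (fun i => fourierCoeff f i • fourier i s) (fourierCoeff f 0 • fourier 0 s) :=
      hasSum_single 0 fun m hm => by rw [h m hm, zero_smul]
    rw [fourier_zero, smul_eq_mul, mul_one] at h2
    exact h1.unique h2
  rw [hc t, hc 0]

theorem fourierCoeff_const {E : Type*} [NormedAddCommGroup E] [NormedSpace ℂ E] [CompleteSpace E]
    (v : E) {m : ℤ} (hm : m ≠ 0) : fourierCoeff (fun _ : UnitAddCircle => v) m = 0 := by
  rw [fourierCoeff, integral_smul_const]
  have h := congrFun (fourierCoeff_fourier (T := 1) 0) m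
  rw [Pi.single_eq_of_ne hm, fourierCoeff] at h
  simp only [fourier_zero, smul_eq_mul, mul_one] at h
  rw [h, zero_smul]

/-- Translation multiplies coefficients by a character and conjugation reverses the index; this
turns vanishing at negative indices into vanishing at positive ones. -/
theorem fourierCoeff_star_comp_add (f : UnitAddCircle → ℂ) (c : UnitAddCircle) (m : ℤ) :
    fourierCoeff (fun t => star (f (t + c))) m
      = fourier m c * star (fourierCoeff f (-m)) := by
  rw [fourierCoeff, fourierCoeff, ← starRingEnd_apply, ← integral_conj]
  conv_rhs => rw [← integral_add_right_eq_self _ c, ← integral_const_mul]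
  refine integral_congr_ae (Filter.Eventually.of_forall fun t => ?_)
  have h : fourier m c * fourier (-m) c = (1 : ℂ) := by
    rw [← fourier_add, add_neg_cancel, fourier_zero]
  simp only [smul_eq_mul, neg_neg, map_mul, fourier_apply, smul_add, toCircle_add,
    Circle.coe_mul, starRingEnd_apply] at h ⊢
  have h2 : ∀ s : UnitAddCircle, star ((toCircle (m • s) : Circle) : ℂ)
      = ((toCircle (-m • s) : Circle) : ℂ) := by
    intro s
    rw [neg_smul, toCircle_neg, Circle.coe_inv_eq_conj, starRingEnd_apply]
  have h3 := h2 t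
  have h4 := h2 c
  rw [h3, h4]
  linear_combination (-((toCircle (-m • t) : Circle) : ℂ) * star (f (t + c))) * h

theorem memLp_of_continuous {E : Type*} [NormedAddCommGroup E] {f : UnitAddCircle → E}
    (hf : Continuous f) : MemLp f 2 (haarAddCircle : Measure UnitAddCircle) :=
  hf.memLp_of_hasCompactSupport (HasCompactSupport.of_compactSpace f)

section

variable {γ : Circle → Mat n} {k : ℕ}

theorem continuous_toEuclideanLin_apply {X : Type*} [TopologicalSpace X] {A : X → Mat n}
    (hA : ∀ i j, Continuous fun x => A x i j) (v : EuclideanSpace ℂ (Fin n)) :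
    Continuous fun x => Matrix.toEuclideanLin (A x) v := by
  refine (PiLp.continuous_toLp 2 _).comp (continuous_pi fun i => ?_)
  change Continuous fun x => ∑ j, A x i j * v j
  exact continuous_finsetSum _ fun j _ => (hA i j).mul continuous_const

/-- The translation by `1 / k` of `ℝ / ℤ`. -/
noncomputable def shift (k : ℕ) : UnitAddCircle := ((1 / k : ℝ) : UnitAddCircle)

theorem toCircle_shift (k : ℕ) : (shift k).toCircle = rootOfUnity k := by
  rw [shift, toCircle_apply_mk, rootOfUnity]
  congr 1
  ring

variable (γ k) in
/-- The loop `t ↦ γ (t + r / k) v`. -/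
noncomputable def shiftedColumn (v : EuclideanSpace ℂ (Fin n)) (r : ℕ) (t : UnitAddCircle) :
    EuclideanSpace ℂ (Fin n) :=
  Matrix.toEuclideanLin (γ (t + r • shift k).toCircle) v

theorem continuous_shiftedColumn (hγ : ∀ i j, Continuous fun ζ => γ ζ i j)
    (v : EuclideanSpace ℂ (Fin n)) (r : ℕ) : Continuous (shiftedColumn γ k v r) :=
  continuous_toEuclideanLin_apply (fun i j => (hγ i j).comp
    (continuous_toCircle.comp (continuous_id.add continuous_const))) v

/-- The constant `v` lies in `H₊`, so `γ v` lies in `γ H₊`; the symmetry is then applied `r` times.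
-/
theorem toLp_shiftedColumn_mem_loopSpace (hγ : ∀ i j, Continuous fun ζ => γ ζ i j)
    (hsym : ∀ f ∈ loopSpace γ, rotate k f ∈ loopSpace γ) (v : EuclideanSpace ℂ (Fin n)) (r : ℕ) :
    (memLp_of_continuous (continuous_shiftedColumn (k := k) hγ v r)).toLp _ ∈ loopSpace γ := by
  induction r with
  | zero =>
    refine ⟨(memLp_of_continuous (continuous_const (y := v))).toLp _, ?_, ?_⟩
    · intro m hm
      rw [fourierCoeff_congr_ae (MemLp.coeFn_toLp _), fourierCoeff_const v hm.ne]
    · filter_upwards [MemLp.coeFn_toLp (memLp_of_continuous (continuous_const (y := v))),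
        MemLp.coeFn_toLp (memLp_of_continuous (continuous_shiftedColumn (k := k) hγ v 0))]
        with t h1 h2
      rw [h1, h2, shiftedColumn, zero_smul, add_zero]
  | succ r ih =>
    have h := hsym _ ih
    rw [rotate, Lp.toLp_compMeasurePreserving] at h
    convert h using 2
    funext t
    simp only [shiftedColumn, Function.comp_apply]
    congr 3
    rw [succ_nsmul', ← add_assoc]
    rfl

/-- The Hardy function producing the `j`-th shifted column is recovered by applying `γ⁻¹ = γ*`; its
`i`-th coordinate is the entry in question. -/
theorem fourierCoeff_shifted_entry_eq_zero (hγ : ∀ i j, Continuous fun ζ => γ ζ i j)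
    (hu : ∀ ζ, γ ζ ∈ Matrix.unitaryGroup (Fin n) ℂ)
    (hsym : ∀ f ∈ loopSpace γ, rotate k f ∈ loopSpace γ) (r : ℕ) (i j : Fin n) {m : ℤ}
    (hm : m < 0) :
    fourierCoeff (fun t : UnitAddCircle =>
      ((γ t.toCircle).conjTranspose * γ (t + r • shift k).toCircle) i j) m = 0 := by
  obtain ⟨h, hh, hae⟩ := toLp_shiftedColumn_mem_loopSpace hγ hsym (EuclideanSpace.single j 1) r
  have hae' : (h : UnitAddCircle → EuclideanSpace ℂ (Fin n)) =ᵐ[haarAddCircle] fun t =>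
      Matrix.toEuclideanLin ((γ t.toCircle).conjTranspose * γ (t + r • shift k).toCircle)
        (EuclideanSpace.single j 1) := by
    filter_upwards [hae, MemLp.coeFn_toLp (memLp_of_continuous
      (continuous_shiftedColumn (k := k) hγ (EuclideanSpace.single j 1) r))] with t h1 h2
    rw [h2, shiftedColumn] at h1
    rw [toEuclideanLin_mul_apply, h1, ← toEuclideanLin_mul_apply, ← Matrix.star_eq_conjTranspose,
      Matrix.mem_unitaryGroup_iff'.1 (hu _), toEuclideanLin_one_apply]
  have h0 := hh m hm
  rw [fourierCoeff_congr_ae hae', fourierCoeff] at h0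
  have hcont : Continuous fun t : UnitAddCircle => fourier (-m) t • Matrix.toEuclideanLin
      ((γ t.toCircle).conjTranspose * γ (t + r • shift k).toCircle)
        (EuclideanSpace.single j (1 : ℂ)) := by
    refine (map_continuous (fourier (-m))).smul (continuous_toEuclideanLin_apply (fun a b => ?_) _)
    simp only [Matrix.mul_apply, Matrix.conjTranspose_apply]
    exact continuous_finsetSum _ fun c _ =>
      (continuous_star.comp ((hγ c a).comp continuous_toCircle)).mul
        ((hγ c b).comp (continuous_toCircle.comp (continuous_id.add continuous_const)))
  have h1 := (EuclideanSpace.proj (𝕜 := ℂ) i).integral_comp_comm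
    ((memLp_of_continuous hcont).integrable one_le_two)
  rw [h0, map_zero] at h1
  rw [fourierCoeff, ← h1]
  refine integral_congr_ae (Filter.Eventually.of_forall fun t => ?_)
  simp only [map_smul, Matrix.toEuclideanLin, Matrix.toLpLin_apply,
    PiLp.ofLp_single, Matrix.mulVec_single_one]
  rfl

/-- If `γ H₊` is invariant under the rotation by `exp (2πi/k)`, then
`γ (exp (2πi/k) ζ) = γ ζ γ (exp (2πi/k))`. -/
theorem apply_rootOfUnity_mul (hk : k ≠ 0) (hγ : ∀ i j, Continuous fun ζ => γ ζ i j)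
    (hu : ∀ ζ, γ ζ ∈ Matrix.unitaryGroup (Fin n) ℂ) (h1 : γ 1 = 1)
    (hsym : ∀ f ∈ loopSpace γ, rotate k f ∈ loopSpace γ) (ζ : Circle) :
    γ (rootOfUnity k * ζ) = γ ζ * γ (rootOfUnity k) := by
  set G : UnitAddCircle → Mat n :=
    fun t => (γ t.toCircle).conjTranspose * γ (t + shift k).toCircle with hG
  have hneg : ∀ i j (m : ℤ), m < 0 → fourierCoeff (fun t => G t i j) m = 0 := by
    intro i j m hm
    have h := fourierCoeff_shifted_entry_eq_zero hγ hu hsym 1 i j hm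
    simpa only [one_smul] using h
  have hkshift : k • shift k = 0 := by
    rw [shift, ← AddCircle.coe_nsmul, nsmul_eq_mul, mul_one_div_cancel (Nat.cast_ne_zero.2 hk)]
    exact AddCircle.coe_period 1
  -- Rotating `k - 1` times is rotating by `-1/k`, and `γ(t)* γ(t - 1/k)` is the adjoint of `G(t -
  -- 1/k)`.
  have hpos : ∀ i j (m : ℤ), 0 < m → fourierCoeff (fun t => G t i j) m = 0 := by
    intro i j m hm
    have h := fourierCoeff_shifted_entry_eq_zero hγ hu hsym (k - 1) j i (neg_lt_zero.2 hm)
    have hshift : (k - 1) • shift k = - shift k := by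
      rw [eq_neg_iff_add_eq_zero, ← succ_nsmul, Nat.sub_add_cancel (Nat.one_le_iff_ne_zero.2 hk),
        hkshift]
    have hfun : (fun t : UnitAddCircle =>
        ((γ t.toCircle).conjTranspose * γ (t + (k - 1) • shift k).toCircle) j i)
        = fun t => star ((fun s => G s i j) (t + -shift k)) := by
      funext t
      simp only [hG]
      rw [hshift, neg_add_cancel_right, ← Matrix.conjTranspose_apply, Matrix.conjTranspose_mul,
        Matrix.conjTranspose_conjTranspose]
    rw [hfun] at h
    have h' := (fourierCoeff_star_comp_add (fun s => G s i j) (-shift k) (-m)).symm.trans h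
    rw [neg_neg, mul_eq_zero] at h'
    rcases h' with h | h
    · rw [fourier_apply] at h
      exact absurd h (Circle.coe_ne_zero _)
    · exact star_eq_zero.1 h
  have hcont : ∀ i j, Continuous fun t => G t i j := by
    intro i j
    simp only [hG, Matrix.mul_apply, Matrix.conjTranspose_apply]
    exact continuous_finsetSum _ fun c _ =>
      (continuous_star.comp ((hγ c i).comp continuous_toCircle)).mul
        ((hγ c j).comp (continuous_toCircle.comp (continuous_id.add continuous_const)))
  have hconst : ∀ t, G t = G 0 := by
    intro t
    ext i j
    refine eq_apply_zero_of_fourierCoeff_eq_zero (hcont i j) (fun m hm => ?_) t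
    rcases lt_or_gt_of_ne hm with h | h
    · exact hneg i j m h
    · exact hpos i j m h
  obtain ⟨t, rfl⟩ := (AddCircle.homeomorphCircle (T := 1) one_ne_zero).surjective ζ
  rw [AddCircle.homeomorphCircle_apply]
  have h := congrArg (γ t.toCircle * ·) (hconst t)
  simp only [hG, toCircle_zero, h1, Matrix.conjTranspose_one, one_mul, toCircle_shift,
    toCircle_add] at h
  rw [← h, ← mul_assoc, ← Matrix.star_eq_conjTranspose, Matrix.mem_unitaryGroup_iff.1 (hu _),
    one_mul, mul_comm]

end

end HarmonicLoops

namespace HarmonicLoops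

variable {n : ℕ}

/-! ### Wirtinger derivatives of matrix-valued functions -/

/-- `(∂F/∂x + s ∂F/∂y) / 2`; the values `s = -i` and `s = i` give `∂F/∂z` and `∂F/∂z̄`. -/
noncomputable def wirt (s : ℂ) (F : ℂ → Mat n) (w : ℂ) : Mat n :=
  Matrix.of fun i j =>
    (fderiv ℝ (fun v => F v i j) w 1 + s * fderiv ℝ (fun v => F v i j) w Complex.I) / 2

/-- Entrywise real differentiability of a matrix-valued function. -/
def EntryDiffAt (F : ℂ → Mat n) (w : ℂ) : Prop :=
  ∀ i j, DifferentiableAt ℝ (fun v => F v i j) w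

theorem dz_eq_wirt (F : ℂ → Mat n) (w : ℂ) : dz F w = wirt (-Complex.I) F w := by
  ext i j
  simp [dz, wirt, sub_eq_add_neg]

section Wirt

variable {s w : ℂ} {F G : ℂ → Mat n}

theorem wirt_mul (hF : EntryDiffAt F w) (hG : EntryDiffAt G w) :
    wirt s (fun v => F v * G v) w = wirt s F w * G w + F w * wirt s G w := by
  ext i j
  have h : ∀ d : ℂ, fderiv ℝ (fun v => (F v * G v) i j) w d
      = ∑ l, (F w i l * fderiv ℝ (fun v => G v l j) w d
        + fderiv ℝ (fun v => F v i l) w d * G w l j) := by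
    intro d
    simp only [Matrix.mul_apply]
    rw [fderiv_fun_sum fun l _ => (hF i l).fun_mul (hG l j), _root_.sum_apply]
    refine Finset.sum_congr rfl fun l _ => ?_
    rw [fderiv_fun_mul (hF i l) (hG l j)]
    simp [mul_comm]
  simp only [wirt, Matrix.of_apply, Matrix.add_apply, Matrix.mul_apply] at h ⊢
  rw [h, h, Finset.mul_sum, ← Finset.sum_add_distrib, ← Finset.sum_add_distrib, Finset.sum_div]
  refine Finset.sum_congr rfl fun l _ => ?_
  ring

theorem wirt_congr (h : F =ᶠ[nhds w] G) : wirt s F w = wirt s G w := by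
  ext i j
  have h' : (fun v => F v i j) =ᶠ[nhds w] fun v => G v i j := h.mono fun v hv => by simp [hv]
  simp [wirt, h'.fderiv_eq]

theorem wirt_const (C : Mat n) : wirt s (fun _ => C) w = 0 := by
  ext i j
  simp [wirt]

theorem entryDiffAt_const (C : Mat n) : EntryDiffAt (fun _ => C) w :=
  fun _ _ => differentiableAt_const _

theorem wirt_sum_smul {ι : Type*} (S : Finset ι) (c : ι → ℂ) {P : ι → ℂ → Mat n}
    (hP : ∀ l ∈ S, EntryDiffAt (P l) w) :
    wirt s (fun v => ∑ l ∈ S, c l • P l v) w = ∑ l ∈ S, c l • wirt s (P l) w := by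
  ext i j
  have h : ∀ d : ℂ, fderiv ℝ (fun v => (∑ l ∈ S, c l • P l v) i j) w d
      = ∑ l ∈ S, c l * fderiv ℝ (fun v => P l v i j) w d := by
    intro d
    simp only [Matrix.sum_apply, Matrix.smul_apply, smul_eq_mul]
    rw [fderiv_fun_sum fun l hl => (hP l hl i j).const_mul _, _root_.sum_apply]
    refine Finset.sum_congr rfl fun l hl => ?_
    rw [fderiv_const_mul (hP l hl i j)]
    simp
  simp only [wirt, Matrix.of_apply, Matrix.sum_apply, Matrix.smul_apply, smul_eq_mul] at h ⊢
  rw [h, h, Finset.mul_sum, ← Finset.sum_add_distrib, Finset.sum_div]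
  refine Finset.sum_congr rfl fun l _ => ?_
  ring

theorem fderiv_entry_eq_zero (h1 : wirt (-Complex.I) F w = 0) (h2 : wirt Complex.I F w = 0)
    (i j : Fin n) : fderiv ℝ (fun v => F v i j) w = 0 := by
  have h1' := congrFun (congrFun h1 i) j
  have h2' := congrFun (congrFun h2 i) j
  simp only [wirt, Matrix.of_apply, Matrix.zero_apply] at h1' h2'
  have e1 : fderiv ℝ (fun v => F v i j) w 1 = 0 := by linear_combination h1' + h2'
  have e2 : fderiv ℝ (fun v => F v i j) w Complex.I = 0 := by
    have : Complex.I * fderiv ℝ (fun v => F v i j) w Complex.I = 0 := by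
      linear_combination h2' - h1'
    exact (mul_eq_zero.1 this).resolve_left Complex.I_ne_zero
  ext z
  rw [← Complex.re_add_im z, map_add]
  have h3 : fderiv ℝ (fun v => F v i j) w (z.re : ℂ) = 0 := by
    rw [← mul_one (z.re : ℂ), ← Complex.real_smul, map_smul, e1, smul_zero]
  have h4 : fderiv ℝ (fun v => F v i j) w (z.im * Complex.I) = 0 := by
    rw [← Complex.real_smul, map_smul, e2, smul_zero]
  rw [h3, h4]
  simp

end Wirt

/-! ### Smooth matrix-valued maps -/

section Smooth

variable {E : Type*} [NormedAddCommGroup E] [NormedSpace ℝ E] {H : Type*} [TopologicalSpace H]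
  {I : ModelWithCorners ℝ E H} {N : Type*} [TopologicalSpace N] [ChartedSpace H N]

theorem contMDiffAt_mul_complex {f g : N → ℂ} {x : N} (hf : ContMDiffAt I 𝓘(ℝ, ℂ) ∞ f x)
    (hg : ContMDiffAt I 𝓘(ℝ, ℂ) ∞ g x) : ContMDiffAt I 𝓘(ℝ, ℂ) ∞ (fun y => f y * g y) x :=
  (contDiff_mul (𝕜 := ℝ) (𝔸 := ℂ)).comp_contMDiffAt (hf.prodMk_space hg)

variable (I) in
/-- Entrywise smoothness of a matrix-valued map at a point. -/
def SmoothMatAt (F : N → Mat n) (x : N) : Prop :=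
  ∀ i j, ContMDiffAt I 𝓘(ℝ, ℂ) ∞ (fun y => F y i j) x

variable {F G : N → Mat n} {x : N}

theorem SmoothMatAt.mul (hF : SmoothMatAt I F x) (hG : SmoothMatAt I G x) :
    SmoothMatAt I (fun y => F y * G y) x := by
  intro i j
  simp only [Matrix.mul_apply]
  exact ContMDiffAt.sum fun l _ => contMDiffAt_mul_complex (hF i l) (hG l j)

theorem SmoothMatAt.smul {f : N → ℂ} (hf : ContMDiffAt I 𝓘(ℝ, ℂ) ∞ f x)
    (hG : SmoothMatAt I G x) : SmoothMatAt I (fun y => f y • G y) x :=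
  fun i j => contMDiffAt_mul_complex hf (hG i j)

theorem SmoothMatAt.sum {ι : Type*} {S : Finset ι} {P : ι → N → Mat n}
    (hP : ∀ l ∈ S, SmoothMatAt I (P l) x) : SmoothMatAt I (fun y => ∑ l ∈ S, P l y) x := by
  intro i j
  simp only [Matrix.sum_apply]
  exact ContMDiffAt.sum fun l hl => hP l hl i j

theorem smoothMatAt_const (C : Mat n) : SmoothMatAt I (fun _ : N => C) x :=
  fun _ _ => contMDiffAt_const

theorem SmoothMatAt.pow (hF : SmoothMatAt I F x) (r : ℕ) :
    SmoothMatAt I (fun y => F y ^ r) x := by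
  induction r with
  | zero => simpa using smoothMatAt_const 1
  | succ r ih => simpa only [pow_succ] using ih.mul hF

theorem SmoothMatAt.conjTranspose (hF : SmoothMatAt I F x) :
    SmoothMatAt I (fun y => (F y).conjTranspose) x :=
  fun i j => Complex.conjCLE.contDiff.comp_contMDiffAt (hF j i)

theorem SmoothMatAt.congr_of_eventuallyEq (hF : SmoothMatAt I F x) (h : G =ᶠ[nhds x] F) :
    SmoothMatAt I G x :=
  fun i j => (hF i j).congr_of_eventuallyEq (h.mono fun y hy => by simp [hy])

theorem SmoothMatAt.spectralProj (hF : SmoothMatAt I F x) (k : ℕ) (w : ℂ) (j : ℕ) :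
    SmoothMatAt I (fun y => spectralProj k w (F y) j) x :=
  SmoothMatAt.smul contMDiffAt_const
    (SmoothMatAt.sum fun r _ => SmoothMatAt.smul contMDiffAt_const (hF.pow r))

variable {E' : Type*} [NormedAddCommGroup E'] [NormedSpace ℝ E'] {H' : Type*}
  [TopologicalSpace H'] {I' : ModelWithCorners ℝ E' H'} {N' : Type*} [TopologicalSpace N']
  [ChartedSpace H' N']

theorem SmoothMatAt.comp {f : N' → N} {y : N'} (hF : SmoothMatAt I F (f y))
    (hf : ContMDiffAt I' I ∞ f y) : SmoothMatAt I' (fun z => F (f z)) y :=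
  fun i j => (hF i j).comp y hf

end Smooth

/-! ### Base points -/

section BasePoint

variable {M : Type*} [TopologicalSpace M]

/-- A base point of the connected component of `p`. -/
noncomputable def basePoint (p : M) : M :=
  Quotient.out (s := connectedComponentSetoid M) (ConnectedComponents.mk p)

theorem connectedComponent_basePoint (p : M) :
    connectedComponent (basePoint p) = connectedComponent p :=
  ConnectedComponents.coe_eq_coe.1
    (Quotient.out_eq (s := connectedComponentSetoid M) (ConnectedComponents.mk p))

theorem apply_basePoint_of_isLocallyConstant {Y : Type*} {f : M → Y} (hf : IsLocallyConstant f)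
    (p : M) : f (basePoint p) = f p :=
  hf.apply_eq_of_isPreconnected isPreconnected_connectedComponent
    (connectedComponent_basePoint p ▸ mem_connectedComponent) mem_connectedComponent

end BasePoint

/-! ### Complex charts as real charts -/

/-- The extended-solution equation uses complex charts while smoothness is real; this lets a complex
chart serve as a real smooth one. -/
theorem contDiffGroupoid_complex_le :
    contDiffGroupoid ω 𝓘(ℂ) ≤ contDiffGroupoid ∞ 𝓘(ℝ, ℂ) := by
  intro e (he : e ∈ contDiffGroupoid ω 𝓘(ℂ))
  change e ∈ contDiffGroupoid ∞ 𝓘(ℝ, ℂ)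
  rw [contDiffGroupoid, mem_groupoid_of_pregroupoid] at he ⊢
  exact ⟨(ContDiffOn.restrict_scalars ℝ he.1).of_le le_top,
    (ContDiffOn.restrict_scalars ℝ he.2).of_le le_top⟩

section Manifold

variable {M : Type*} [TopologicalSpace M] [ChartedSpace ℂ M]

theorem mem_real_maximalAtlas {e : OpenPartialHomeomorph M ℂ}
    (he : e ∈ IsManifold.maximalAtlas 𝓘(ℂ) ω M) : e ∈ IsManifold.maximalAtlas 𝓘(ℝ, ℂ) ∞ M :=
  StructureGroupoid.maximalAtlas_mono contDiffGroupoid_complex_le he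

theorem SmoothMatAt.entryDiffAt {F : M → Mat n} (hF : ∀ p, SmoothMatAt 𝓘(ℝ, ℂ) F p)
    {e : OpenPartialHomeomorph M ℂ} (he : e ∈ IsManifold.maximalAtlas 𝓘(ℂ) ω M) {w : ℂ}
    (hw : w ∈ e.target) : EntryDiffAt (fun v => F (e.symm v)) w := by
  intro i j
  have h1 : ContMDiffAt 𝓘(ℝ, ℂ) 𝓘(ℝ, ℂ) ∞ e.symm w :=
    (contMDiffOn_symm_of_mem_maximalAtlas (mem_real_maximalAtlas he)).contMDiffAt
      (e.open_target.mem_nhds hw)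
  have h2 := (hF (e.symm w) i j).comp w h1
  rw [contMDiffAt_iff_contDiffAt] at h2
  exact h2.differentiableAt (by simp)

theorem isLocallyConstant_of_wirt_eq_zero [IsManifold 𝓘(ℂ) ω M] {F : M → Mat n}
    (hF : ∀ p, SmoothMatAt 𝓘(ℝ, ℂ) F p)
    (h : ∀ e ∈ IsManifold.maximalAtlas 𝓘(ℂ) ω M, ∀ w ∈ e.target,
      wirt (-Complex.I) (fun v => F (e.symm v)) w = 0 ∧
      wirt Complex.I (fun v => F (e.symm v)) w = 0) : IsLocallyConstant F := by
  rw [IsLocallyConstant.iff_eventually_eq]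
  intro p
  have he : chartAt ℂ p ∈ IsManifold.maximalAtlas 𝓘(ℂ) ω M := IsManifold.chart_mem_maximalAtlas p
  have hp := mem_chart_source ℂ p
  generalize chartAt ℂ p = e at he hp
  have hij : ∀ i j, ∀ᶠ q in nhds p, F q i j = F p i j := by
    intro i j
    -- The two Wirtinger derivatives determine the real differential, which therefore vanishes, so
    -- level sets are open in the chart.
    have hopen := e.open_target.isOpen_inter_preimage_of_fderiv_eq_zero (𝕜 := ℝ)
      (f := fun v => F (e.symm v) i j)
      (fun w hw => ((SmoothMatAt.entryDiffAt hF he hw) i j).differentiableWithinAt)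
      (fun w hw => fderiv_entry_eq_zero (h e he w hw).1 (h e he w hw).2 i j) {F p i j}
    have hmem : e p ∈ e.target ∩ (fun v => F (e.symm v) i j) ⁻¹' {F p i j} :=
      ⟨e.map_source hp, by simp [e.left_inv hp]⟩
    have h1 := (e.continuousAt hp).eventually (hopen.mem_nhds hmem)
    filter_upwards [h1, e.open_source.mem_nhds hp] with q hq hqs
    have := hq.2
    simpa [e.left_inv hqs] using this
  have := Filter.eventually_all.2 fun i => Filter.eventually_all.2 (hij i)
  filter_upwards [this] with q hq
  ext i j
  exact hq i j

/-- Components are open because `M` is locally modelled on `ℂ`. `M` need not be connected, so each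
component has its own base point. -/
theorem isLocallyConstant_basePoint : IsLocallyConstant (basePoint : M → M) := by
  have := ChartedSpace.locallyConnectedSpace ℂ M
  rw [IsLocallyConstant.iff_eventually_eq]
  intro p
  filter_upwards [isOpen_connectedComponent.mem_nhds (mem_connectedComponent (x := p))] with q hq
  rw [basePoint, basePoint, ConnectedComponents.coe_eq_coe.2 (connectedComponent_eq hq)]

/-! ### Extended solutions -/

theorem unitary_inv {A : Mat n} (hA : A ∈ Matrix.unitaryGroup (Fin n) ℂ) :
    A⁻¹ = A.conjTranspose :=
  Matrix.inv_eq_left_inv (Matrix.mem_unitaryGroup_iff'.1 hA)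

theorem conjTranspose_mem_unitaryGroup {A : Mat n} (hA : A ∈ Matrix.unitaryGroup (Fin n) ℂ) :
    A.conjTranspose ∈ Matrix.unitaryGroup (Fin n) ℂ :=
  Unitary.star_mem hA

/-- `F⁻¹ dF` evaluated in the chart `e`, for a unitary matrix-valued map. -/
noncomputable def logWirt (s : ℂ) (e : OpenPartialHomeomorph M ℂ) (F : M → Mat n) (w : ℂ) : Mat n :=
  (F (e.symm w))⁻¹ * wirt s (fun v => F (e.symm v)) w

namespace IsExtendedSolution

variable {Φ Θ : Circle → M → Mat n}

theorem smoothMatAt (h : IsExtendedSolution Φ) (q : Circle × M) :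
    SmoothMatAt ((𝓡 1).prod 𝓘(ℝ, ℂ)) (fun q : Circle × M => Φ q.1 q.2) q :=
  fun i j => h.smooth i j q

theorem smoothMatAt_right (h : IsExtendedSolution Φ) (ζ : Circle) (p : M) :
    SmoothMatAt 𝓘(ℝ, ℂ) (Φ ζ) p :=
  (h.smoothMatAt (ζ, p)).comp (f := fun p => (ζ, p))
    (contMDiffAt_const.prodMk contMDiffAt_id)

theorem continuous_left (h : IsExtendedSolution Φ) (p : M) (i j : Fin n) :
    Continuous fun ζ => Φ ζ p i j :=
  (h.smooth i j).continuous.comp (continuous_id.prodMk continuous_const)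

theorem exists_logWirt (h : IsExtendedSolution Φ) {e : OpenPartialHomeomorph M ℂ}
    (he : e ∈ IsManifold.maximalAtlas 𝓘(ℂ) ω M) {w : ℂ} (hw : w ∈ e.target) :
    ∃ A B : Mat n, ∀ ζ : Circle, logWirt (-Complex.I) e (Φ ζ) w = (1 - (ζ : ℂ)⁻¹) • A ∧
      logWirt Complex.I e (Φ ζ) w = (1 - (ζ : ℂ)) • B := by
  obtain ⟨A, B, hAB⟩ := h.form e he
  refine ⟨A w, B w, fun ζ => ?_⟩
  have := hAB ζ w hw
  rwa [dz_eq_wirt] at this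

theorem of_logWirt (hu : ∀ ζ p, Φ ζ p ∈ Matrix.unitaryGroup (Fin n) ℂ)
    (hs : ∀ q, SmoothMatAt ((𝓡 1).prod 𝓘(ℝ, ℂ)) (fun q : Circle × M => Φ q.1 q.2) q)
    (h1 : ∀ p, Φ 1 p = 1)
    (h : ∀ e ∈ IsManifold.maximalAtlas 𝓘(ℂ) ω M, ∀ w ∈ e.target, ∃ A B : Mat n, ∀ ζ : Circle,
      logWirt (-Complex.I) e (Φ ζ) w = (1 - (ζ : ℂ)⁻¹) • A ∧
      logWirt Complex.I e (Φ ζ) w = (1 - (ζ : ℂ)) • B) : IsExtendedSolution Φ where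
  unitary := hu
  smooth i j := fun q => hs q i j
  based := h1
  form e he := by
    have h' := h e he
    choose! A B hAB using h'
    refine ⟨A, B, fun ζ w hw => ?_⟩
    rw [dz_eq_wirt]
    exact hAB w hw ζ

theorem isSmoothUnitary (h : IsExtendedSolution Φ) (ζ : Circle) : IsSmoothUnitary (Φ ζ) where
  unitary := h.unitary ζ
  smooth i j := fun p => h.smoothMatAt_right ζ p i j

/-- An extended solution is associated to its value at `ζ = -1`. -/
theorem isAssociated (h : IsExtendedSolution Φ) : IsAssociated Φ (Φ (-1)) := by
  intro e he ζ w hw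
  obtain ⟨A, B, hAB⟩ := h.form e he
  have hm1 : ((-1 : Circle) : ℂ) = -1 := rfl
  -- At `ζ = -1` both scalar factors equal `2`, which cancels the `1/2` of the definition.
  rw [(hAB ζ w hw).1, (hAB ζ w hw).2, (hAB (-1) w hw).1, (hAB (-1) w hw).2, hm1]
  constructor <;> congr 1 <;> rw [smul_smul] <;> norm_num

/-- Two extended solutions with the same `Φ⁻¹ dΦ` differ by a locally constant left factor. -/
theorem isLocallyConstant_mul_conjTranspose [IsManifold 𝓘(ℂ) ω M] (hΦ : IsExtendedSolution Φ)
    (hΘ : IsExtendedSolution Θ) (ζ : Circle)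
    (h : ∀ e ∈ IsManifold.maximalAtlas 𝓘(ℂ) ω M, ∀ w ∈ e.target,
      logWirt (-Complex.I) e (Θ ζ) w = logWirt (-Complex.I) e (Φ ζ) w ∧
      logWirt Complex.I e (Θ ζ) w = logWirt Complex.I e (Φ ζ) w) :
    IsLocallyConstant fun p => Θ ζ p * (Φ ζ p).conjTranspose := by
  have hs : ∀ p, SmoothMatAt 𝓘(ℝ, ℂ) (fun p => (Φ ζ p).conjTranspose) p :=
    fun p => (hΦ.smoothMatAt_right ζ p).conjTranspose
  refine isLocallyConstant_of_wirt_eq_zero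
    (fun p => (hΘ.smoothMatAt_right ζ p).mul (hs p)) fun e he w hw => ?_
  have key : ∀ s : ℂ, logWirt s e (Θ ζ) w = logWirt s e (Φ ζ) w →
      wirt s (fun v => Θ ζ (e.symm v) * (Φ ζ (e.symm v)).conjTranspose) w = 0 := by
    intro s hsΘ
    have dΦ := SmoothMatAt.entryDiffAt (hΦ.smoothMatAt_right ζ) he hw
    have dΘ := SmoothMatAt.entryDiffAt (hΘ.smoothMatAt_right ζ) he hw
    have dΦ' := SmoothMatAt.entryDiffAt hs he hw
    have h1 : ∀ v, (Φ ζ (e.symm v)).conjTranspose * Φ ζ (e.symm v) = 1 :=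
      fun v => Matrix.mem_unitaryGroup_iff'.1 (hΦ.unitary ζ _)
    have h2 : ∀ v, Φ ζ (e.symm v) * (Φ ζ (e.symm v)).conjTranspose = 1 :=
      fun v => Matrix.mem_unitaryGroup_iff.1 (hΦ.unitary ζ _)
    have h3 : Θ ζ (e.symm w) * (Θ ζ (e.symm w)).conjTranspose = 1 :=
      Matrix.mem_unitaryGroup_iff.1 (hΘ.unitary ζ _)
    -- Differentiating `Φ* Φ = 1` expresses the derivative of `Φ*` through that of `Φ`.
    have hinv := wirt_mul (s := s) dΦ' dΦ
    simp only [h1, wirt_const] at hinv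
    rw [logWirt, logWirt, unitary_inv (hΘ.unitary ζ _), unitary_inv (hΦ.unitary ζ _)] at hsΘ
    have hΘ' : wirt s (fun v => Θ ζ (e.symm v)) w = Θ ζ (e.symm w) *
        ((Φ ζ (e.symm w)).conjTranspose * wirt s (fun v => Φ ζ (e.symm v)) w) := by
      rw [← hsΘ, ← mul_assoc, h3, one_mul]
    have hΦ' : wirt s (fun v => (Φ ζ (e.symm v)).conjTranspose) w
        = -((Φ ζ (e.symm w)).conjTranspose * wirt s (fun v => Φ ζ (e.symm v)) w *
          (Φ ζ (e.symm w)).conjTranspose) := by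
      have := congrArg (· * (Φ ζ (e.symm w)).conjTranspose) hinv
      simp only [zero_mul, add_mul, mul_assoc, h2, mul_one] at this
      rw [eq_neg_iff_add_eq_zero, mul_assoc]
      exact this.symm
    rw [wirt_mul dΘ dΦ', hΘ', hΦ']
    noncomm_ring
  exact ⟨key _ (h e he w hw).1, key _ (h e he w hw).2⟩

end IsExtendedSolution

/-- The extended solution `Φ(ζ, p₀)⁻¹ Φ(ζ, p)`, normalized at the base point `p₀` of the component
of `p`. -/
noncomputable def normalized (Φ : Circle → M → Mat n) (ζ : Circle) (p : M) : Mat n :=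
  (Φ ζ (basePoint p)).conjTranspose * Φ ζ p

theorem isTrigPolynomial_iff {N : Type*} {Φ : Circle → N → Mat n} :
    IsTrigPolynomial Φ ↔ ∃ K : ℕ, ∀ p, (fun ζ => Φ ζ p) ∈ laurent n (-(K : ℤ)) K := by
  constructor
  · rintro ⟨K, T, h⟩
    exact ⟨K, fun p => mem_laurent_iff.2 ⟨fun m => T m p, fun ζ => h ζ p⟩⟩
  · rintro ⟨K, h⟩
    choose X hX using fun p => mem_laurent_iff.1 (h p)
    exact ⟨K, fun m p => X p m, fun ζ p => hX p ζ⟩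

namespace IsExtendedSolution

variable {Φ : Circle → M → Mat n}

/-- Near a point the base point is fixed, so normalizing multiplies on the left by a constant
unitary matrix, which cancels. -/
theorem logWirt_normalized (h : IsExtendedSolution Φ) (s : ℂ) {e : OpenPartialHomeomorph M ℂ}
    (he : e ∈ IsManifold.maximalAtlas 𝓘(ℂ) ω M) {w : ℂ} (hw : w ∈ e.target) (ζ : Circle) :
    logWirt s e (normalized Φ ζ) w = logWirt s e (Φ ζ) w := by
  have hloc : (fun v => normalized Φ ζ (e.symm v)) =ᶠ[nhds w] fun v =>
      (Φ ζ (basePoint (e.symm w))).conjTranspose * Φ ζ (e.symm v) := by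
    have := (e.continuousAt_symm hw).eventually
      (isLocallyConstant_basePoint.eventually_eq (e.symm w))
    filter_upwards [this] with v hv
    rw [normalized, hv]
  rw [logWirt, wirt_congr hloc, wirt_mul (entryDiffAt_const _)
    (SmoothMatAt.entryDiffAt (h.smoothMatAt_right ζ) he hw), wirt_const, zero_mul, zero_add,
    normalized, Matrix.mul_inv_rev, unitary_inv (conjTranspose_mem_unitaryGroup (h.unitary ζ _)),
    Matrix.conjTranspose_conjTranspose, mul_assoc, ← mul_assoc (Φ ζ (basePoint _)),
    ← Matrix.star_eq_conjTranspose, Matrix.mem_unitaryGroup_iff.1 (h.unitary ζ _), one_mul, logWirt]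

theorem isExtendedSolution_normalized (h : IsExtendedSolution Φ) :
    IsExtendedSolution (normalized Φ) := by
  refine of_logWirt (fun ζ p => mul_mem (conjTranspose_mem_unitaryGroup (h.unitary ζ _))
    (h.unitary ζ p)) ?_ (fun p => by simp [normalized, h.based]) ?_
  · rintro ⟨ζ₀, p₀⟩
    have h1 : SmoothMatAt ((𝓡 1).prod 𝓘(ℝ, ℂ))
        (fun q : Circle × M => Φ q.1 (basePoint p₀)) (ζ₀, p₀) :=
      SmoothMatAt.comp (F := fun q : Circle × M => Φ q.1 q.2) (h.smoothMatAt (ζ₀, basePoint p₀))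
        (f := fun q : Circle × M => (q.1, basePoint p₀))
        (y := (ζ₀, p₀)) (contMDiffAt_fst.prodMk contMDiffAt_const)
    refine (h1.conjTranspose.mul (h.smoothMatAt (ζ₀, p₀))).congr_of_eventuallyEq ?_
    have := (continuousAt_snd (p := ((ζ₀, p₀) : Circle × M))).eventually
      (isLocallyConstant_basePoint.eventually_eq p₀)
    filter_upwards [this] with q hq
    rw [normalized, hq]
  · intro e he w hw
    obtain ⟨A, B, hAB⟩ := h.exists_logWirt he hw
    refine ⟨A, B, fun ζ => ?_⟩
    rw [h.logWirt_normalized _ he hw, h.logWirt_normalized _ he hw]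
    exact hAB ζ

/-- `Φ(-1, ·)` has finite uniton number if and only if the normalized extended solution is a
trigonometric polynomial. -/
theorem hasFiniteUnitonNumber_iff [IsManifold 𝓘(ℂ) ω M] (h : IsExtendedSolution Φ) :
    HasFiniteUnitonNumber (Φ (-1)) ↔ IsTrigPolynomial (normalized Φ) := by
  constructor
  · rintro ⟨-, Θ, hΘ, hass, hpol⟩
    rw [isTrigPolynomial_iff] at hpol ⊢
    obtain ⟨K, hK⟩ := hpol
    refine ⟨K + K, fun p => ?_⟩
    -- `Θ Φ*` takes the same value at `p` and at its base point, so `Φ` and `Θ` have the same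
    -- normalization.
    have heq : (fun ζ => normalized Φ ζ p)
        = (fun ζ => (Θ ζ (basePoint p)).conjTranspose) * fun ζ => Θ ζ p := by
      funext ζ
      have hloc := h.isLocallyConstant_mul_conjTranspose hΘ ζ fun e he w hw => by
        have h1 := hass e he ζ w hw
        have h2 := h.isAssociated e he ζ w hw
        rw [← h2.1, ← h2.2, dz_eq_wirt, dz_eq_wirt] at h1
        exact h1
      have hb := apply_basePoint_of_isLocallyConstant hloc p
      have hb' := congrArg (fun X => (Θ ζ (basePoint p)).conjTranspose * X * Φ ζ p) hb
      have e1 : (Θ ζ (basePoint p)).conjTranspose * Θ ζ (basePoint p) = 1 :=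
        Matrix.mem_unitaryGroup_iff'.1 (hΘ.unitary ζ _)
      have e2 : (Φ ζ p).conjTranspose * Φ ζ p = 1 :=
        Matrix.mem_unitaryGroup_iff'.1 (h.unitary ζ _)
      simp only [mul_assoc, e2, mul_one] at hb'
      rw [← mul_assoc, e1, one_mul] at hb'
      exact hb'
    rw [heq]
    have := mul_mem_laurent (conjTranspose_mem_laurent (hK (basePoint p))) (hK p)
    exact laurent_mono (by push_cast; omega) (by push_cast; omega) this
  · intro hpol
    refine ⟨h.isSmoothUnitary _, normalized Φ, h.isExtendedSolution_normalized, ?_, hpol⟩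
    intro e he ζ w hw
    have h1 := h.logWirt_normalized (-Complex.I) he hw ζ
    have h2 := h.logWirt_normalized Complex.I he hw ζ
    have h3 := h.isAssociated e he ζ w hw
    rw [logWirt, logWirt, ← dz_eq_wirt, ← dz_eq_wirt] at h1
    rw [h1, ← h3.1, ← h3.2]
    exact ⟨rfl, h2⟩

end IsExtendedSolution

end Manifold

end HarmonicLoops

namespace HarmonicLoops

variable {n k : ℕ}

/-! ### Invariant Laurent polynomials vanishing at `1` -/

section Laurent

variable {F : Circle → Mat n} {w : Circle}

theorem filter_dvd_Icc_neg (hk : k ≠ 0) :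
    ({m ∈ Finset.Icc (-(k : ℤ)) (k - 1) | (k : ℤ) ∣ m}) = {-(k : ℤ), 0} := by
  have hk' : (0 : ℤ) < k := by omega
  ext m
  simp only [Finset.mem_filter, Finset.mem_Icc, Finset.mem_insert, Finset.mem_singleton]
  constructor
  · rintro ⟨⟨h1, h2⟩, c, rfl⟩
    have hc1 : -1 ≤ c := by nlinarith
    have hc2 : c < 1 := by nlinarith
    obtain rfl | rfl : c = -1 ∨ c = 0 := by omega
    · left; ring
    · right; ring
  · rintro (rfl | rfl)
    · exact ⟨⟨le_rfl, by omega⟩, by simp⟩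
    · exact ⟨⟨by omega, by omega⟩, dvd_zero _⟩

theorem filter_dvd_Icc_pos (hk : k ≠ 0) :
    ({m ∈ Finset.Icc (1 - (k : ℤ)) k | (k : ℤ) ∣ m}) = {(k : ℤ), 0} := by
  have hk' : (0 : ℤ) < k := by omega
  ext m
  simp only [Finset.mem_filter, Finset.mem_Icc, Finset.mem_insert, Finset.mem_singleton]
  constructor
  · rintro ⟨⟨h1, h2⟩, c, rfl⟩
    have hc1 : -1 < c := by nlinarith
    have hc2 : c ≤ 1 := by nlinarith
    obtain rfl | rfl : c = 1 ∨ c = 0 := by omega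
    · left; ring
    · right; ring
  · rintro (rfl | rfl)
    · exact ⟨⟨by omega, le_rfl⟩, dvd_rfl⟩
    · exact ⟨⟨by omega, by omega⟩, dvd_zero _⟩

/-- Only the exponents `-k` and `0` survive invariance, and vanishing at `1` makes their
coefficients opposite. -/
theorem exists_eq_one_sub_inv_smul (hk : k ≠ 0) (hw : IsPrimitiveRoot (w : ℂ) k)
    (hF : F ∈ laurent n (-(k : ℤ)) (k - 1)) (hinv : ∀ ζ, F (w * ζ) = F ζ) (h1 : F 1 = 0) :
    ∃ C : Mat n, ∀ ζ : Circle, F ζ = (1 - ((ζ ^ k : Circle) : ℂ)⁻¹) • C := by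
  obtain ⟨X, hX⟩ := exists_eq_sum_dvd_of_invariant hk hw hF hinv
  rw [filter_dvd_Icc_neg hk] at hX
  have hne : -(k : ℤ) ≠ 0 := by omega
  simp only [Finset.sum_pair hne] at hX
  have h0 := hX 1
  simp only [h1, Circle.coe_one, one_zpow, one_smul] at h0
  refine ⟨X 0, fun ζ => ?_⟩
  rw [hX, eq_neg_of_add_eq_zero_left h0.symm, zpow_neg, zpow_natCast, Circle.coe_pow, sub_smul]
  simp only [zpow_zero, one_smul, smul_neg]
  abel

theorem exists_eq_one_sub_smul (hk : k ≠ 0) (hw : IsPrimitiveRoot (w : ℂ) k)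
    (hF : F ∈ laurent n (1 - (k : ℤ)) k) (hinv : ∀ ζ, F (w * ζ) = F ζ) (h1 : F 1 = 0) :
    ∃ C : Mat n, ∀ ζ : Circle, F ζ = (1 - ((ζ ^ k : Circle) : ℂ)) • C := by
  obtain ⟨X, hX⟩ := exists_eq_sum_dvd_of_invariant hk hw hF hinv
  rw [filter_dvd_Icc_pos hk] at hX
  have hne : (k : ℤ) ≠ 0 := by omega
  simp only [Finset.sum_pair hne] at hX
  have h0 := hX 1
  simp only [h1, Circle.coe_one, one_zpow, one_smul] at h0
  refine ⟨X 0, fun ζ => ?_⟩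
  rw [hX, eq_neg_of_add_eq_zero_left h0.symm, zpow_natCast, Circle.coe_pow, sub_smul]
  simp only [zpow_zero, one_smul, smul_neg]
  abel

end Laurent

/-! ### Roots on the circle -/

theorem exp_arg_div_pow (hk : k ≠ 0) (ζ : Circle) :
    Circle.exp (Complex.arg ζ / k) ^ k = ζ := by
  rw [← Circle.exp_nsmul, nsmul_eq_mul, mul_div_cancel₀ _ (Nat.cast_ne_zero.2 hk), Circle.exp_arg]

theorem exists_eq_rootOfUnity_pow_mul (hk : k ≠ 0) {ζ η : Circle} (h : η ^ k = ζ ^ k) :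
    ∃ r : ℕ, η = rootOfUnity k ^ r * ζ := by
  have h1 : ((η : ℂ) / ζ) ^ k = 1 := by
    rw [div_pow, ← Circle.coe_pow, h, Circle.coe_pow, div_self (pow_ne_zero _ ζ.coe_ne_zero)]
  have : NeZero k := ⟨hk⟩
  obtain ⟨r, -, hr⟩ := (isPrimitiveRoot_rootOfUnity hk).eq_pow_of_pow_eq_one h1
  refine ⟨r, Circle.ext ?_⟩
  rw [Circle.coe_mul, Circle.coe_pow, hr, div_mul_cancel₀ _ ζ.coe_ne_zero]

theorem contMDiff_coe_circle :
    ContMDiff (𝓡 1) 𝓘(ℝ, ℂ) ∞ (fun ζ : Circle => (ζ : ℂ)) :=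
  haveI := _root_.finrank_real_complex_fact'
  contMDiff_coe_sphere (E := ℂ) (n := 1)

/-- A `k`-th root on the circle that is smooth near `ζ₀`. -/
noncomputable def localRoot (k : ℕ) (ζ₀ ζ : Circle) : Circle :=
  Circle.exp (Complex.arg ζ₀ / k) * Circle.exp (Complex.arg (ζ * ζ₀⁻¹ : Circle) / k)

theorem localRoot_pow (hk : k ≠ 0) (ζ₀ ζ : Circle) : localRoot k ζ₀ ζ ^ k = ζ := by
  rw [localRoot, mul_pow, exp_arg_div_pow hk, exp_arg_div_pow hk, mul_comm, inv_mul_cancel_right]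

/-- The argument is taken of `ζ ζ₀⁻¹`, which is near `1` and so away from the branch cut. The
principal root itself would fail at `-1`. -/
theorem contMDiffAt_localRoot (k : ℕ) (ζ₀ : Circle) :
    ContMDiffAt (𝓡 1) (𝓡 1) ∞ (localRoot k ζ₀) ζ₀ := by
  have h1 : ContMDiffAt (𝓡 1) 𝓘(ℝ, ℂ) ∞ (fun ζ : Circle => ((ζ * ζ₀⁻¹ : Circle) : ℂ)) ζ₀ :=
    contMDiff_coe_circle.contMDiffAt.comp ζ₀ (contMDiffAt_id.mul contMDiffAt_const)
  have h2 : ContDiffAt ℝ ∞ (fun z : ℂ => Complex.arg z / k) ((ζ₀ * ζ₀⁻¹ : Circle) : ℂ) := by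
    have h3 : ContDiffAt ℂ ∞ Complex.log ((ζ₀ * ζ₀⁻¹ : Circle) : ℂ) :=
      Complex.contDiffAt_log (by simp)
    have h4 := (Complex.imCLM.contDiff.contDiffAt.comp _ (h3.restrict_scalars ℝ)).div_const (k : ℝ)
    simpa [Function.comp_def, Complex.log_im] using h4
  have h5 : ContMDiffAt (𝓡 1) 𝓘(ℝ, ℝ) ∞
      (fun ζ : Circle => Complex.arg ((ζ * ζ₀⁻¹ : Circle) : ℂ) / k) ζ₀ :=
    ContDiffAt.comp_contMDiffAt (g := fun z : ℂ => Complex.arg z / k) h2 h1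
  exact contMDiffAt_const.mul (contMDiff_circleExp.contMDiffAt.comp ζ₀ h5)

/-! ### The twisted loop -/

section Twisted

theorem twistedLoop_eq {N : Type*} {Φ : Circle → N → Mat n} (ζ : Circle) (p : N) :
    twistedLoop k Φ ζ p = Φ ζ p * gradingLoop k (fun j => eigenProj k Φ j p) ζ := rfl

variable {M : Type*} [TopologicalSpace M] [ChartedSpace ℂ M] {Φ : Circle → M → Mat n}

namespace IsExtendedSolution

theorem apply_rootOfUnity_mul (hΦ : IsExtendedSolution Φ) (hsym : IsKSymmetric k Φ) (hk : k ≠ 0)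
    (ζ : Circle) (p : M) : Φ (rootOfUnity k * ζ) p = Φ ζ p * Φ (rootOfUnity k) p :=
  HarmonicLoops.apply_rootOfUnity_mul (γ := fun ζ => Φ ζ p) hk (hΦ.continuous_left p)
    (fun ζ => hΦ.unitary ζ p) (hΦ.based p) (hsym p) ζ

theorem pow_rootOfUnity_eq_one (hΦ : IsExtendedSolution Φ) (hsym : IsKSymmetric k Φ) (hk : k ≠ 0)
    (p : M) : Φ (rootOfUnity k) p ^ k = 1 := by
  have h : ∀ r : ℕ, Φ (rootOfUnity k ^ r) p = Φ (rootOfUnity k) p ^ r := by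
    intro r
    induction r with
    | zero => simp [hΦ.based]
    | succ r ih => rw [pow_succ', hΦ.apply_rootOfUnity_mul hsym hk, ih, pow_succ]
  rw [← h, rootOfUnity_pow hk, hΦ.based]

theorem eigenProj_eq_spectralProj (hΦ : IsExtendedSolution Φ) (hsym : IsKSymmetric k Φ)
    (hk : k ≠ 0) (j : ℕ) (p : M) :
    eigenProj k Φ j p = spectralProj k (rootOfUnity k) (Φ (rootOfUnity k) p) j :=
  projMatrix_ker_eq_spectralProj (isPrimitiveRoot_rootOfUnity hk) hk (hΦ.unitary _ p)
    (hΦ.pow_rootOfUnity_eq_one hsym hk p) j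

theorem isProjSystem_eigenProj (hΦ : IsExtendedSolution Φ) (hsym : IsKSymmetric k Φ)
    (hk : k ≠ 0) (p : M) : IsProjSystem k fun j => eigenProj k Φ j p where
  sum_eq := by
    simp only [hΦ.eigenProj_eq_spectralProj hsym hk]
    exact sum_spectralProj (isPrimitiveRoot_rootOfUnity hk) hk
  mul_eq i hi j hj := by
    simp only [hΦ.eigenProj_eq_spectralProj hsym hk]
    exact spectralProj_mul (isPrimitiveRoot_rootOfUnity hk) (Circle.coe_ne_zero _) hk
      (hΦ.pow_rootOfUnity_eq_one hsym hk p) hi hj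
  herm _ := conjTranspose_projMatrix _

/-- The factor `φ_k` gained by `Φ` acts on `π_j` as `ω^j`, which cancels the `ω^(-j)` gained by
`ζ^(-j)`. -/
theorem twistedLoop_rootOfUnity_mul (hΦ : IsExtendedSolution Φ) (hsym : IsKSymmetric k Φ)
    (hk : k ≠ 0) (ζ : Circle) :
    twistedLoop k Φ (rootOfUnity k * ζ) = twistedLoop k Φ ζ := by
  funext p
  rw [twistedLoop_eq, twistedLoop_eq, hΦ.apply_rootOfUnity_mul hsym hk, mul_assoc]
  congr 1
  rw [gradingLoop, gradingLoop, Finset.mul_sum]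
  refine Finset.sum_congr rfl fun j _ => ?_
  have h0 := (rootOfUnity k).coe_ne_zero
  rw [hΦ.eigenProj_eq_spectralProj hsym hk, Matrix.mul_smul,
    mul_spectralProj (isPrimitiveRoot_rootOfUnity hk) h0 (hΦ.pow_rootOfUnity_eq_one hsym hk p),
    smul_smul, Circle.coe_mul, mul_zpow, mul_right_comm, zpow_neg, zpow_natCast,
    inv_mul_cancel₀ (pow_ne_zero _ h0), one_mul]

theorem twistedLoop_eq_of_pow_eq (hΦ : IsExtendedSolution Φ) (hsym : IsKSymmetric k Φ)
    (hk : k ≠ 0) {ζ η : Circle} (h : η ^ k = ζ ^ k) : twistedLoop k Φ η = twistedLoop k Φ ζ := by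
  obtain ⟨r, rfl⟩ := exists_eq_rootOfUnity_pow_mul hk h
  clear h
  induction r with
  | zero => simp
  | succ r ih => rw [pow_succ', mul_assoc, hΦ.twistedLoop_rootOfUnity_mul hsym hk, ih]

theorem reducedLoop_pow (hΦ : IsExtendedSolution Φ) (hsym : IsKSymmetric k Φ)
    (hk : k ≠ 0) (ζ : Circle) : reducedLoop k Φ (ζ ^ k) = twistedLoop k Φ ζ :=
  hΦ.twistedLoop_eq_of_pow_eq hsym hk (exp_arg_div_pow hk _)

theorem twistedLoop_mem_unitaryGroup (hΦ : IsExtendedSolution Φ) (hsym : IsKSymmetric k Φ)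
    (hk : k ≠ 0) (ζ : Circle) (p : M) :
    twistedLoop k Φ ζ p ∈ Matrix.unitaryGroup (Fin n) ℂ :=
  mul_mem (hΦ.unitary ζ p) ((hΦ.isProjSystem_eigenProj hsym hk p).gradingLoop_mem_unitaryGroup ζ)

theorem twistedLoop_one (hΦ : IsExtendedSolution Φ) (hsym : IsKSymmetric k Φ)
    (hk : k ≠ 0) (p : M) : twistedLoop k Φ 1 p = 1 := by
  rw [twistedLoop_eq, hΦ.based, (hΦ.isProjSystem_eigenProj hsym hk p).gradingLoop_one, one_mul]

theorem smoothMatAt_eigenProj (hΦ : IsExtendedSolution Φ) (hsym : IsKSymmetric k Φ)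
    (hk : k ≠ 0) (j : ℕ) (p : M) : SmoothMatAt 𝓘(ℝ, ℂ) (eigenProj k Φ j) p := by
  have : eigenProj k Φ j = fun p => spectralProj k (rootOfUnity k) (Φ (rootOfUnity k) p) j :=
    funext fun p => hΦ.eigenProj_eq_spectralProj hsym hk j p
  rw [this]
  exact (hΦ.smoothMatAt_right _ p).spectralProj k _ j

theorem smoothMatAt_twistedLoop (hΦ : IsExtendedSolution Φ) (hsym : IsKSymmetric k Φ)
    (hk : k ≠ 0) (q : Circle × M) :
    SmoothMatAt ((𝓡 1).prod 𝓘(ℝ, ℂ)) (fun q : Circle × M => twistedLoop k Φ q.1 q.2) q := by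
  refine (hΦ.smoothMatAt q).mul (SmoothMatAt.sum fun j _ => SmoothMatAt.smul ?_
    ((hΦ.smoothMatAt_eigenProj hsym hk j q.2).comp (f := Prod.snd) contMDiffAt_snd))
  -- On the circle `ζ^(-j)` is the `j`-th power of the conjugate, which is smooth on all of `ℂ`.
  have h1 : ContDiff ℝ ∞ fun z : ℂ => (Complex.conjCLE z) ^ j := Complex.conjCLE.contDiff.pow j
  have h2 := h1.comp_contMDiffAt
    ((contMDiff_coe_circle q.1).comp q (contMDiffAt_fst (I := 𝓡 1) (J := 𝓘(ℝ, ℂ))))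
  refine h2.congr_of_eventuallyEq (Filter.Eventually.of_forall fun y => ?_)
  simp [← Circle.coe_inv_eq_conj]

/-- The twisted loop does not depend on the choice of `k`-th root, so near each point a smooth root
may replace the principal one. -/
theorem smoothMatAt_reducedLoop (hΦ : IsExtendedSolution Φ) (hsym : IsKSymmetric k Φ)
    (hk : k ≠ 0) (q : Circle × M) :
    SmoothMatAt ((𝓡 1).prod 𝓘(ℝ, ℂ)) (fun q : Circle × M => reducedLoop k Φ q.1 q.2) q := by
  have h : (fun y : Circle × M => reducedLoop k Φ y.1 y.2)
      = fun y => twistedLoop k Φ (localRoot k q.1 y.1) y.2 := by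
    funext y
    nth_rewrite 1 [← localRoot_pow hk q.1 y.1]
    rw [hΦ.reducedLoop_pow hsym hk]
  rw [h]
  exact SmoothMatAt.comp (F := fun q : Circle × M => twistedLoop k Φ q.1 q.2)
    (f := fun y : Circle × M => (localRoot k q.1 y.1, y.2))
    (hΦ.smoothMatAt_twistedLoop hsym hk _)
    (((contMDiffAt_localRoot k q.1).comp q contMDiffAt_fst).prodMk contMDiffAt_snd)

/-! ### The logarithmic derivative of the twisted loop -/

theorem logWirt_twistedLoop (hΦ : IsExtendedSolution Φ) (hsym : IsKSymmetric k Φ) (hk : k ≠ 0)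
    (s : ℂ) {e : OpenPartialHomeomorph M ℂ} (he : e ∈ IsManifold.maximalAtlas 𝓘(ℂ) ω M) {w : ℂ}
    (hw : w ∈ e.target) (ζ : Circle) :
    logWirt s e (twistedLoop k Φ ζ) w =
      (gradingLoop k (fun j => eigenProj k Φ j (e.symm w)) ζ).conjTranspose *
        logWirt s e (Φ ζ) w * gradingLoop k (fun j => eigenProj k Φ j (e.symm w)) ζ +
      (gradingLoop k (fun j => eigenProj k Φ j (e.symm w)) ζ).conjTranspose *
        gradingLoop k (fun j => wirt s (fun v => eigenProj k Φ j (e.symm v)) w) ζ := by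
  have dP : ∀ j, EntryDiffAt (fun v => eigenProj k Φ j (e.symm v)) w := fun j =>
    SmoothMatAt.entryDiffAt (hΦ.smoothMatAt_eigenProj hsym hk j) he hw
  have dγ : EntryDiffAt
      (fun v => gradingLoop k (fun j => eigenProj k Φ j (e.symm v)) ζ) w :=
    SmoothMatAt.entryDiffAt (F := fun p => gradingLoop k (fun j => eigenProj k Φ j p) ζ)
      (fun p => SmoothMatAt.sum fun j _ => SmoothMatAt.smul contMDiffAt_const
        (hΦ.smoothMatAt_eigenProj hsym hk j p)) he hw
  have dΦ := SmoothMatAt.entryDiffAt (hΦ.smoothMatAt_right ζ) he hw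
  have hγ := wirt_sum_smul (s := s) (Finset.range k) (fun j => (ζ : ℂ) ^ (-(j : ℤ)))
    (fun j _ => dP j)
  have hu : (Φ ζ (e.symm w)).conjTranspose * Φ ζ (e.symm w) = 1 :=
    Matrix.mem_unitaryGroup_iff'.1 (hΦ.unitary ζ _)
  have hmul := wirt_mul (s := s) dΦ dγ
  simp only [gradingLoop] at hmul hγ ⊢
  rw [logWirt, logWirt, unitary_inv (hΦ.twistedLoop_mem_unitaryGroup hsym hk ζ _),
    unitary_inv (hΦ.unitary ζ _)]
  simp only [twistedLoop, Matrix.conjTranspose_mul]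
  rw [hmul, hγ, mul_add]
  congr 1
  · simp only [mul_assoc]
  · rw [mul_assoc, ← mul_assoc (Φ ζ (e.symm w)).conjTranspose, hu, one_mul]

/-- `γ` has exponents in `[1-k, 0]` and `γ*` in `[0, k-1]`. The term `γ* dγ` fits in the same window
because `a ≤ 0 ≤ b`. -/
theorem logWirt_twistedLoop_mem_laurent (hΦ : IsExtendedSolution Φ) (hsym : IsKSymmetric k Φ)
    (hk : k ≠ 0) (s : ℂ) {e : OpenPartialHomeomorph M ℂ}
    (he : e ∈ IsManifold.maximalAtlas 𝓘(ℂ) ω M) {w : ℂ} (hw : w ∈ e.target) {a b : ℤ}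
    (ha : a ≤ 0) (hb : 0 ≤ b) (h : (fun ζ => logWirt s e (Φ ζ) w) ∈ laurent n a b) :
    (fun ζ => logWirt s e (twistedLoop k Φ ζ) w) ∈ laurent n (a + (1 - k)) (b + (k - 1)) := by
  have hγ := gradingLoop_mem_laurent k fun j => eigenProj k Φ j (e.symm w)
  have hγ' := conjTranspose_mem_laurent hγ
  have hγd := gradingLoop_mem_laurent k fun j => wirt s (fun v => eigenProj k Φ j (e.symm v)) w
  have hsum := add_mem
    (laurent_mono (c := a + (1 - k)) (d := b + (k - 1)) (by omega) (by omega)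
      (mul_mem_laurent (mul_mem_laurent hγ' h) hγ))
    (laurent_mono (c := a + (1 - k)) (d := b + (k - 1)) (by omega) (by omega)
      (mul_mem_laurent hγ' hγd))
  convert hsum using 1
  funext ζ
  exact hΦ.logWirt_twistedLoop hsym hk s he hw ζ

theorem isExtendedSolution_reducedLoop (hΦ : IsExtendedSolution Φ) (hsym : IsKSymmetric k Φ)
    (hk : k ≠ 0) : IsExtendedSolution (reducedLoop k Φ) := by
  refine of_logWirt (fun ζ p => hΦ.twistedLoop_mem_unitaryGroup hsym hk _ p)
    (hΦ.smoothMatAt_reducedLoop hsym hk) (fun p => ?_) fun e he w hw => ?_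
  · rw [← one_pow k, hΦ.reducedLoop_pow hsym hk, hΦ.twistedLoop_one hsym hk]
  · obtain ⟨A, B, hAB⟩ := hΦ.exists_logWirt he hw
    have hinv : ∀ (s : ℂ) (ζ : Circle), logWirt s e (twistedLoop k Φ (rootOfUnity k * ζ)) w
        = logWirt s e (twistedLoop k Φ ζ) w := by
      intro s ζ
      rw [hΦ.twistedLoop_rootOfUnity_mul hsym hk]
    -- At `ζ = 1` the twisted loop is identically `I`.
    have hone : ∀ s, logWirt s e (twistedLoop k Φ 1) w = 0 := by
      intro s
      simp only [logWirt, hΦ.twistedLoop_one hsym hk, wirt_const, mul_zero]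
    have hA : (fun ζ => logWirt (-Complex.I) e (Φ ζ) w) ∈ laurent n (-1) 0 := by
      have h1 := sub_mem (monomial_mem_laurent (a := -1) (m := 0) (by omega) le_rfl A)
        (monomial_mem_laurent (b := 0) (m := -1) le_rfl (by omega) A)
      convert h1 using 1
      funext ζ
      simp [(hAB ζ).1, sub_smul]
    have hB : (fun ζ => logWirt Complex.I e (Φ ζ) w) ∈ laurent n 0 1 := by
      have h1 := sub_mem (monomial_mem_laurent (b := 1) (m := 0) le_rfl (by omega) B)
        (monomial_mem_laurent (a := 0) (m := 1) (by omega) le_rfl B)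
      convert h1 using 1
      funext ζ
      simp [(hAB ζ).2, sub_smul]
    have hA' := hΦ.logWirt_twistedLoop_mem_laurent hsym hk _ he hw (by omega) le_rfl hA
    have hB' := hΦ.logWirt_twistedLoop_mem_laurent hsym hk _ he hw le_rfl (by omega) hB
    obtain ⟨C, hC⟩ := exists_eq_one_sub_inv_smul hk (isPrimitiveRoot_rootOfUnity hk)
      (laurent_mono (by omega) (by omega) hA') (hinv _) (hone _)
    obtain ⟨D, hD⟩ := exists_eq_one_sub_smul hk (isPrimitiveRoot_rootOfUnity hk)
      (laurent_mono (by omega) (by omega) hB') (hinv _) (hone _)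
    refine ⟨C, D, fun ζ => ?_⟩
    have h1 := hC (Circle.exp (Complex.arg ζ / k))
    have h2 := hD (Circle.exp (Complex.arg ζ / k))
    rw [exp_arg_div_pow hk] at h1 h2
    exact ⟨h1, h2⟩

/-! ### Comparison of the normalized loops -/

theorem normalized_reducedLoop_pow (hΦ : IsExtendedSolution Φ) (hsym : IsKSymmetric k Φ)
    (hk : k ≠ 0) (ζ : Circle) (p : M) :
    normalized (reducedLoop k Φ) (ζ ^ k) p =
      (gradingLoop k (fun j => eigenProj k Φ j (basePoint p)) ζ).conjTranspose *
        normalized Φ ζ p * gradingLoop k (fun j => eigenProj k Φ j p) ζ := by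
  rw [normalized, hΦ.reducedLoop_pow hsym hk, twistedLoop_eq, twistedLoop_eq,
    Matrix.conjTranspose_mul, normalized]
  simp only [mul_assoc]

theorem isTrigPolynomial_normalized_reducedLoop_iff (hΦ : IsExtendedSolution Φ)
    (hsym : IsKSymmetric k Φ) (hk : k ≠ 0) :
    IsTrigPolynomial (normalized Φ) ↔ IsTrigPolynomial (normalized (reducedLoop k Φ)) := by
  have hk1 : 1 ≤ k := Nat.one_le_iff_ne_zero.2 hk
  have hγ := fun p => gradingLoop_mem_laurent k fun j => eigenProj k Φ j p
  have hγ' := fun p => conjTranspose_mem_laurent (hγ p)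
  rw [isTrigPolynomial_iff, isTrigPolynomial_iff]
  constructor
  · rintro ⟨K, hK⟩
    refine ⟨K + k, fun p => ?_⟩
    have hF : (fun ζ => normalized (reducedLoop k Φ) (ζ ^ k) p)
        ∈ laurent n (-((K + k : ℕ) : ℤ)) (K + k : ℕ) := by
      have h := laurent_mono (c := -((K + k : ℕ) : ℤ)) (d := (K + k : ℕ)) (by push_cast; omega)
        (by push_cast; omega) (mul_mem_laurent (mul_mem_laurent (hγ' (basePoint p)) (hK p)) (hγ p))
      convert h using 1
      funext ζ
      exact hΦ.normalized_reducedLoop_pow hsym hk ζ p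
    obtain ⟨X, hX⟩ := exists_eq_sum_dvd_of_invariant hk (isPrimitiveRoot_rootOfUnity hk) hF
      fun ζ => by rw [mul_pow, rootOfUnity_pow hk, one_mul]
    -- As a function of `ζ` with `ζ ^ k = η`, the loop only has exponents divisible by `k`, so `ζ^m
    -- = η^(m/k)`.
    have heq : (fun η => normalized (reducedLoop k Φ) η p)
        = ∑ m ∈ Finset.Icc (-((K + k : ℕ) : ℤ)) (K + k : ℕ) with (k : ℤ) ∣ m,
          fun η : Circle => (η : ℂ) ^ (m / k) • X m := by
      funext η
      have h := hX (Circle.exp (Complex.arg η / k))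
      rw [exp_arg_div_pow hk] at h
      rw [h, Finset.sum_apply]
      refine Finset.sum_congr rfl fun m hm => ?_
      obtain ⟨c, rfl⟩ := (Finset.mem_filter.1 hm).2
      rw [Int.mul_ediv_cancel_left _ (Nat.cast_ne_zero.2 hk), zpow_mul, zpow_natCast,
        ← Circle.coe_pow, exp_arg_div_pow hk]
    rw [heq]
    refine Submodule.sum_mem _ fun m hm => ?_
    obtain ⟨hm, c, rfl⟩ := Finset.mem_filter.1 hm
    obtain ⟨h1, h2⟩ := Finset.mem_Icc.1 hm
    have hk2 : (1 : ℤ) ≤ k := by exact_mod_cast hk1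
    rw [Int.mul_ediv_cancel_left _ (Nat.cast_ne_zero.2 hk)]
    refine monomial_mem_laurent ?_ ?_ _
    -- The old bound still serves, since `|c| ≤ |kc|`.
    · rcases le_total 0 c with hc | hc
      · omega
      · nlinarith
    · rcases le_total 0 c with hc | hc
      · nlinarith
      · omega
  · rintro ⟨K, hK⟩
    -- Substituting `ζ^k` multiplies the degree by `k`; undoing the two unitary factors `γ` adds at
    -- most `k - 1` on either side.
    refine ⟨k * K + k, fun p => ?_⟩
    obtain ⟨X, hX⟩ := mem_laurent_iff.1 (hK p)
    have hF : (fun ζ => normalized (reducedLoop k Φ) (ζ ^ k) p)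
        ∈ laurent n (-((k * K : ℕ) : ℤ)) (k * K : ℕ) := by
      have heq : (fun ζ => normalized (reducedLoop k Φ) (ζ ^ k) p)
          = ∑ m ∈ Finset.Icc (-(K : ℤ)) K, fun ζ : Circle => (ζ : ℂ) ^ (k * m) • X m := by
        funext ζ
        rw [hX (ζ ^ k), Finset.sum_apply]
        refine Finset.sum_congr rfl fun m _ => ?_
        rw [zpow_mul, zpow_natCast, Circle.coe_pow]
      rw [heq]
      refine Submodule.sum_mem _ fun m hm => ?_
      obtain ⟨h1, h2⟩ := Finset.mem_Icc.1 hm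
      refine monomial_mem_laurent ?_ ?_ _
      · push_cast
        nlinarith
      · push_cast
        nlinarith
    have h := laurent_mono (c := -((k * K + k : ℕ) : ℤ)) (d := (k * K + k : ℕ))
      (by push_cast; omega) (by push_cast; omega)
      (mul_mem_laurent (mul_mem_laurent (hγ (basePoint p)) hF) (hγ' p))
    convert h using 1
    funext ζ
    have e1 := Matrix.mem_unitaryGroup_iff.1
      ((hΦ.isProjSystem_eigenProj hsym hk (basePoint p)).gradingLoop_mem_unitaryGroup ζ)
    have e2 := Matrix.mem_unitaryGroup_iff.1
      ((hΦ.isProjSystem_eigenProj hsym hk p).gradingLoop_mem_unitaryGroup ζ)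
    simp only [Pi.mul_apply, hΦ.normalized_reducedLoop_pow hsym hk, mul_assoc]
    rw [← Matrix.star_eq_conjTranspose, ← Matrix.star_eq_conjTranspose, e2, mul_one, ← mul_assoc,
      e1, one_mul]

end IsExtendedSolution

end Twisted

end HarmonicLoops

theorem proposition4p3 {M : Type*} [TopologicalSpace M] [ChartedSpace ℂ M] [IsManifold 𝓘(ℂ) ω M]
    {n k : ℕ} (hk : 2 ≤ k) (Φ : Circle → M → Mat n)
    (hΦ : IsExtendedSolution Φ) (hsym : IsKSymmetric k Φ) :
    (∀ (ζ : Circle) (p : M), reducedLoop k Φ (ζ ^ k) p = twistedLoop k Φ ζ p) ∧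
      IsExtendedSolution (reducedLoop k Φ) ∧
      (HasFiniteUnitonNumber (Φ (-1)) ↔ HasFiniteUnitonNumber (reducedLoop k Φ (-1))) := by
  have hk0 : k ≠ 0 := by omega
  have hΨ := hΦ.isExtendedSolution_reducedLoop hsym hk0
  refine ⟨fun ζ p => congrFun (hΦ.reducedLoop_pow hsym hk0 ζ) p, hΨ, ?_⟩
  rw [hΦ.hasFiniteUnitonNumber_iff, hΨ.hasFiniteUnitonNumber_iff]
  exact hΦ.isTrigPolynomial_normalized_reducedLoop_iff hsym hk0
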